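/- Let $(\mathfrak{X},+,\mathcal{A})$ be a measurable Abelian group, i.e. a commutative group with a $\sigma$-algebra $\mathcal{A}$ such that $(x,y)\mapsto x-y$ is $\mathcal{A}\otimes\mathcal{A}$-$\mathcal{A}$-measurable. Products and powers of finite signed measures on $(\mathfrak{X},\mathcal{A})$ are taken in the convolution sense, empty products being the Dirac measure at $0$; $\|V\|=|V|(\mathfrak{X})$ is the total variation norm, and $V|_A=V(A\cap\cdot\,)$ is the restriction of $V$ to $A\in\mathcal{A}$. Let $n\in\mathbb{N}=\{1,2,\dots\}$, let $F_1,\dots,F_n,G$ be probability measures on $(\mathfrak{X},\mathcal{A})$, and put $F_0=\overline F=\frac1n\sum_{j=1}^nF_j$, $$V_k=\sum_{J\subseteq\{1,\dots,n\},\,|J|=k}\ \prod_{j\in J}(F_j-G)\quad(0\le k\le n),\qquad W_\ell=\sum_{k=0}^{\ell}V_kG^{n-k}\quad(0\le\ell\le n).$$ For $j,k\in\{1,\dots,n\}$ and $m\in\mathbb{N}$ set $M_{j,k}=(F_j-G)G^{\lfloor(n-k)/k\rfloor}$, $\nu_{k,m}=\sum_{j=1}^n\|M_{j,k}\|^m$,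 $\widetilde\nu_k=\big\|\sum_{j=1}^nM_{j,k}\big\|$. For $\ell\in\{0,\dots,n\}$ and $\alpha\in[0,\infty)$ set $$\eta_{\ell,\alpha}=\max_{\ell<k\le n}\Big[\frac1{k^{1+\alpha}}\Big(\frac{\widetilde\nu_k^2}{4c_1}+\nu_{k,2}\Big)\Big]\quad(\text{with }\eta_{n,\alpha}=0),\qquad\eta_\ell=\eta_{\ell,0},$$ where $$c_1=\sup_{x\in(0,\infty)}\frac{\ln(2-(1-x)e^x)}{x^2}=0.694025\ldots,$$ that is, the supremum is finite and $0.694025\le c_1<0.694026$. (a) Let $\alpha\in[0,\infty)$, $\ell\in\{0,\dots,n\}$ and $\beta=\lceil\alpha(\ell+1)/2\rceil$. If $\eta_\ell<(2ec_1)^{-1}$, then $$\Big\|\prod_{j=1}^nF_j-W_\ell\Big\|\le(\ell+1)^\beta\,\beta!\,\frac{(2ec_1\eta_{\ell,\alpha})^{(\ell+1)/2}}{\big(1-\sqrt{2ec_1\eta_\ell}\big)^{\beta+1}}.$$ In particular (for $\alpha=0$), under the same condition, $$\Big\|\prod_{j=1}^nF_j-W_\ell\Big\|\le\frac{(2ec_1\eta_{\ell})^{(\ell+1)/2}}{1-\sqrt{2ec_1\eta_\ell}}.$$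 (b) Assume that, for each $j\in\{0,\dots,n\}$, $B_j\in\mathcal{A}$ is such that $F_j|_{B_j^{\mathrm c}}\ll G$, and let $f_j$ be a Radon–Nikodym density of $F_j|_{B_j^{\mathrm c}}$ with respect to $G$. Then, for every $\ell\in\{0,\dots,n\}$, $$\eta_\ell\le\frac1{4c_1}\Big[\frac n{\sqrt{\ell+1}}\Big(\big\|(\overline F-G)|_{B_0}\big\|+\big|(\overline F-G)(B_0)\big|\Big)+\sqrt{2n}\Big(\int_{B_0^{\mathrm c}}(f_0-1)^2\,dG\Big)^{1/2}\Big]^2$$ $$\qquad+\sum_{j=1}^n\Big[\frac1{\sqrt{\ell+1}}\Big(\big\|(F_j-G)|_{B_j}\big\|+\big|(F_j-G)(B_j)\big|\Big)+\sqrt{\frac2n}\Big(\int_{B_j^{\mathrm c}}(f_j-1)^2\,dG\Big)^{1/2}\Big]^2,$$ where the right-hand side may be $+\infty$. -/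

import Mathlib

open MeasureTheory Set
open scoped ENNReal NNReal

namespace ConvExpansion

section Convolution

variable {𝔛 : Type*} [AddCommGroup 𝔛] [MeasurableSpace 𝔛]

/-- In a measurable Abelian group, i.e. when `(x, y) ↦ x - y` is measurable, addition is
measurable as well. -/
theorem measurableAdd₂_of_sub [MeasurableSub₂ 𝔛] : MeasurableAdd₂ 𝔛 := by
  refine ⟨?_⟩
  have h : (fun p : 𝔛 × 𝔛 => p.1 + p.2) = fun p => p.1 - (0 - p.2) := by
    funext p; simp
  rw [h]
  fun_prop

/-- The convolution `V W` of two finite signed measures: the bilinear extension, through the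
Hahn-Jordan decompositions `V = V⁺ - V⁻` and `W = W⁺ - W⁻`, of the convolution of finite
measures. -/
noncomputable def sconv (V W : SignedMeasure 𝔛) : SignedMeasure 𝔛 :=
  (V.toJordanDecomposition.posPart.conv W.toJordanDecomposition.posPart).toSignedMeasure
    + (V.toJordanDecomposition.negPart.conv W.toJordanDecomposition.negPart).toSignedMeasure
    - ((V.toJordanDecomposition.posPart.conv W.toJordanDecomposition.negPart).toSignedMeasure
      + (V.toJordanDecomposition.negPart.conv W.toJordanDecomposition.posPart).toSignedMeasure)

theorem eq_pos_sub_neg {𝔛 : Type*} [MeasurableSpace 𝔛] (V : SignedMeasure 𝔛) :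
    V = V.toJordanDecomposition.posPart.toSignedMeasure
      - V.toJordanDecomposition.negPart.toSignedMeasure :=
  (SignedMeasure.toSignedMeasure_toJordanDecomposition V).symm

theorem tsm_conv_comm [MeasurableSub₂ 𝔛] (a b : Measure 𝔛) [IsFiniteMeasure a]
    [IsFiniteMeasure b] : (a.conv b).toSignedMeasure = (b.conv a).toSignedMeasure := by
  have : MeasurableAdd₂ 𝔛 := measurableAdd₂_of_sub
  congr 1
  exact Measure.conv_comm a b

theorem tsm_add_conv [MeasurableSub₂ 𝔛] (a b c : Measure 𝔛) [IsFiniteMeasure a]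
    [IsFiniteMeasure b] [IsFiniteMeasure c] :
    ((a + b).conv c).toSignedMeasure = (a.conv c).toSignedMeasure + (b.conv c).toSignedMeasure := by
  have : MeasurableAdd₂ 𝔛 := measurableAdd₂_of_sub
  rw [← Measure.toSignedMeasure_add]
  congr 1
  exact Measure.add_conv a b c

/-- If `a - b = a' - b'`, then convolving with `c` preserves the equality. -/
theorem tsm_conv_congr [MeasurableSub₂ 𝔛] {a b a' b' : Measure 𝔛} (c : Measure 𝔛)
    [IsFiniteMeasure a] [IsFiniteMeasure b] [IsFiniteMeasure a'] [IsFiniteMeasure b']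
    [IsFiniteMeasure c]
    (h : a.toSignedMeasure - b.toSignedMeasure = a'.toSignedMeasure - b'.toSignedMeasure) :
    (a.conv c).toSignedMeasure - (b.conv c).toSignedMeasure
      = (a'.conv c).toSignedMeasure - (b'.conv c).toSignedMeasure := by
  rw [sub_eq_sub_iff_add_eq_add] at h ⊢
  rw [← Measure.toSignedMeasure_add, ← Measure.toSignedMeasure_add,
    Measure.toSignedMeasure_eq_toSignedMeasure_iff] at h
  rw [← tsm_add_conv, ← tsm_add_conv]
  congr 2

/-- The convolution may be computed from any representations as differences of finite measures. -/
theorem sconv_sub_sub [MeasurableSub₂ 𝔛] (a b c d : Measure 𝔛)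
    [IsFiniteMeasure a] [IsFiniteMeasure b] [IsFiniteMeasure c] [IsFiniteMeasure d] :
    sconv (a.toSignedMeasure - b.toSignedMeasure) (c.toSignedMeasure - d.toSignedMeasure)
      = (a.conv c).toSignedMeasure + (b.conv d).toSignedMeasure
        - ((a.conv d).toSignedMeasure + (b.conv c).toSignedMeasure) := by
  set V := a.toSignedMeasure - b.toSignedMeasure with hV
  set W := c.toSignedMeasure - d.toSignedMeasure with hW
  have h1 := (eq_pos_sub_neg V).symm.trans hV
  have h2 := (eq_pos_sub_neg W).symm.trans hW
  have e1 := tsm_conv_congr W.toJordanDecomposition.posPart h1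
  have e2 := tsm_conv_congr W.toJordanDecomposition.negPart h1
  have e3 := tsm_conv_congr a h2
  have e4 := tsm_conv_congr b h2
  rw [tsm_conv_comm _ a, tsm_conv_comm _ a, tsm_conv_comm _ a, tsm_conv_comm _ a] at e3
  rw [tsm_conv_comm _ b, tsm_conv_comm _ b, tsm_conv_comm _ b, tsm_conv_comm _ b] at e4
  unfold sconv
  rw [sub_eq_iff_eq_add] at e1 e2 e3 e4
  rw [← sub_eq_zero]
  linear_combination (norm := module) e1 - e2 + e3 - e4

theorem sconv_comm [MeasurableSub₂ 𝔛] (V W : SignedMeasure 𝔛) : sconv V W = sconv W V := by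
  rw [eq_pos_sub_neg V, eq_pos_sub_neg W, sconv_sub_sub, sconv_sub_sub,
    tsm_conv_comm W.toJordanDecomposition.posPart, tsm_conv_comm W.toJordanDecomposition.posPart,
    tsm_conv_comm W.toJordanDecomposition.negPart, tsm_conv_comm W.toJordanDecomposition.negPart]
  abel

theorem sconv_sub_sub' [MeasurableSub₂ 𝔛] (a b c d : Measure 𝔛)
    [IsFiniteMeasure a] [IsFiniteMeasure b] [IsFiniteMeasure c] [IsFiniteMeasure d] :
    sconv (a.toSignedMeasure - b.toSignedMeasure) (c.toSignedMeasure - d.toSignedMeasure)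
      = (a.conv c + b.conv d).toSignedMeasure - (a.conv d + b.conv c).toSignedMeasure := by
  rw [sconv_sub_sub, Measure.toSignedMeasure_add, Measure.toSignedMeasure_add]

theorem tsm_conv_assoc [MeasurableSub₂ 𝔛] (a b c : Measure 𝔛) [IsFiniteMeasure a]
    [IsFiniteMeasure b] [IsFiniteMeasure c] :
    ((a.conv b).conv c).toSignedMeasure = (a.conv (b.conv c)).toSignedMeasure := by
  have : MeasurableAdd₂ 𝔛 := measurableAdd₂_of_sub
  congr 1
  exact Measure.conv_assoc a b c

theorem tsm_conv_add [MeasurableSub₂ 𝔛] (a b c : Measure 𝔛) [IsFiniteMeasure a]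
    [IsFiniteMeasure b] [IsFiniteMeasure c] :
    (a.conv (b + c)).toSignedMeasure = (a.conv b).toSignedMeasure + (a.conv c).toSignedMeasure := by
  rw [tsm_conv_comm, tsm_add_conv, tsm_conv_comm b, tsm_conv_comm c]

theorem sconv_assoc [MeasurableSub₂ 𝔛] (U V W : SignedMeasure 𝔛) :
    sconv (sconv U V) W = sconv U (sconv V W) := by
  rw [eq_pos_sub_neg U, eq_pos_sub_neg V, eq_pos_sub_neg W,
    sconv_sub_sub' U.toJordanDecomposition.posPart,
    sconv_sub_sub' V.toJordanDecomposition.posPart, sconv_sub_sub, sconv_sub_sub]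
  simp only [tsm_add_conv, tsm_conv_add, tsm_conv_assoc]
  abel

theorem sconv_add_left [MeasurableSub₂ 𝔛] (U V W : SignedMeasure 𝔛) :
    sconv (U + V) W = sconv U W + sconv V W := by
  have h : U + V = (U.toJordanDecomposition.posPart
        + V.toJordanDecomposition.posPart).toSignedMeasure
      - (U.toJordanDecomposition.negPart + V.toJordanDecomposition.negPart).toSignedMeasure := by
    rw [Measure.toSignedMeasure_add, Measure.toSignedMeasure_add]
    conv_lhs => rw [eq_pos_sub_neg U, eq_pos_sub_neg V]
    abel
  rw [h]
  conv_lhs => rw [eq_pos_sub_neg W, sconv_sub_sub]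
  unfold sconv
  simp only [tsm_add_conv]
  abel

/-- On non-negative measures, `sconv` is the convolution of measures. -/
theorem sconv_toSignedMeasure [MeasurableSub₂ 𝔛] (μ ν : Measure 𝔛) [IsFiniteMeasure μ]
    [IsFiniteMeasure ν] :
    sconv μ.toSignedMeasure ν.toSignedMeasure = (μ.conv ν).toSignedMeasure := by
  have h := sconv_sub_sub μ 0 ν 0
  have h1 : (Measure.conv (0 : Measure 𝔛) ν) = 0 := Measure.zero_conv ν
  have h2 : (Measure.conv (0 : Measure 𝔛) 0) = 0 := Measure.zero_conv 0
  have h3 : (Measure.conv μ (0 : Measure 𝔛)) = 0 := Measure.conv_zero μ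
  simpa [h1, h2, h3] using h

theorem one_sconv [MeasurableSub₂ 𝔛] (V : SignedMeasure 𝔛) :
    sconv (Measure.dirac (0 : 𝔛)).toSignedMeasure V = V := by
  have : MeasurableAdd₂ 𝔛 := measurableAdd₂_of_sub
  have h := sconv_sub_sub (Measure.dirac (0 : 𝔛)) 0 V.toJordanDecomposition.posPart
    V.toJordanDecomposition.negPart
  rw [← eq_pos_sub_neg V] at h
  simp only [Measure.dirac_zero_conv, Measure.zero_conv, Measure.toSignedMeasure_zero, sub_zero,
    add_zero] at h
  rw [h]
  exact (eq_pos_sub_neg V).symm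

theorem zero_sconv [MeasurableSub₂ 𝔛] (V : SignedMeasure 𝔛) : sconv 0 V = 0 := by
  have h := sconv_add_left 0 0 V
  rw [add_zero] at h
  exact left_eq_add.mp h

/-- The finite signed measures on a measurable Abelian group form a commutative ring with respect
to setwise addition and convolution, with unit the Dirac measure at `0`. In particular, products
and powers of signed measures below are convolution products and powers, empty ones being the
Dirac measure at `0`. -/
noncomputable instance instCommRingSignedMeasure [MeasurableSub₂ 𝔛] :
    CommRing (SignedMeasure 𝔛) :=
  { (inferInstance : AddCommGroup (SignedMeasure 𝔛)) with
    mul := sconv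
    one := (Measure.dirac (0 : 𝔛)).toSignedMeasure
    mul_assoc := sconv_assoc
    mul_comm := sconv_comm
    one_mul := one_sconv
    mul_one := fun V => (sconv_comm V _).trans (one_sconv V)
    left_distrib := fun U V W => by
      change sconv U (V + W) = sconv U V + sconv U W
      rw [sconv_comm, sconv_add_left, sconv_comm V, sconv_comm W]
    right_distrib := sconv_add_left
    zero_mul := zero_sconv
    mul_zero := fun V => (sconv_comm V 0).trans (zero_sconv V) }

end Convolution

/-- The total variation norm `‖V‖ = |V|(𝔛)` of a finite signed measure. -/
noncomputable def tvNorm {𝔛 : Type*} [MeasurableSpace 𝔛] (V : SignedMeasure 𝔛) : ℝ :=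
  V.totalVariation.real univ

/-- The function `x ↦ ln (2 - (1 - x) eˣ) / x²`. -/
noncomputable def h₁ (x : ℝ) : ℝ := Real.log (2 - (1 - x) * Real.exp x) / x ^ 2

/-- The constant `c₁`, the supremum of `h₁` over `(0, ∞)`. -/
noncomputable def c₁ : ℝ := sSup (h₁ '' Ioi 0)

/-- The arithmetic mean `F̄ = (1/n) ∑ⱼ Fⱼ`. -/
noncomputable def meanMeasure {𝔛 : Type*} [MeasurableSpace 𝔛] {n : ℕ} (F : Fin n → Measure 𝔛) :
    Measure 𝔛 :=
  (n : ℝ≥0)⁻¹ • ∑ j, F j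

instance instIsFiniteMeasureMeanMeasure {𝔛 : Type*} [MeasurableSpace 𝔛] {n : ℕ}
    (F : Fin n → Measure 𝔛) [∀ j, IsFiniteMeasure (F j)] : IsFiniteMeasure (meanMeasure F) := by
  unfold meanMeasure
  infer_instance

section Expansion

variable {𝔛 : Type*} [AddCommGroup 𝔛] [MeasurableSpace 𝔛] [MeasurableSub₂ 𝔛] {n : ℕ}
  (F : Fin n → Measure 𝔛) (G : Measure 𝔛) [∀ j, IsFiniteMeasure (F j)] [IsFiniteMeasure G]

/-- `Vₖ`, the `k`-th elementary symmetric (convolution) polynomial in the `Fⱼ - G`. -/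
noncomputable def V (k : ℕ) : SignedMeasure 𝔛 :=
  ∑ J ∈ (Finset.univ : Finset (Fin n)).powersetCard k,
    ∏ j ∈ J, ((F j).toSignedMeasure - G.toSignedMeasure)

/-- `W_ℓ = ∑_{k=0}^ℓ Vₖ G^{n-k}`, for `ℓ ≤ n`. -/
noncomputable def W (ℓ : ℕ) : SignedMeasure 𝔛 :=
  ∑ k ∈ Finset.range (ℓ + 1), V F G k * G.toSignedMeasure ^ (n - k)

/-- `M_{j,k} = (Fⱼ - G) G^{⌊(n-k)/k⌋}`, for `1 ≤ k ≤ n`. -/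
noncomputable def M (j : Fin n) (k : ℕ) : SignedMeasure 𝔛 :=
  ((F j).toSignedMeasure - G.toSignedMeasure) * G.toSignedMeasure ^ ((n - k) / k)

/-- `ν_{k,m} = ∑ⱼ ‖M_{j,k}‖ᵐ`. -/
noncomputable def nu (k m : ℕ) : ℝ := ∑ j, tvNorm (M F G j k) ^ m

/-- `ν̃ₖ = ‖∑ⱼ M_{j,k}‖`. -/
noncomputable def nuTilde (k : ℕ) : ℝ := tvNorm (∑ j, M F G j k)

/-- `η_{ℓ,α}`, the maximum over `k ∈ {ℓ+1, …, n}` of `k^{-(1+α)} (ν̃ₖ² / (4 c₁) + ν_{k,2})`.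
It is a maximum of finitely many non-negative numbers; for `ℓ = n` the index set is empty and the
value is `0`. -/
noncomputable def eta (ℓ : ℕ) (α : ℝ) : ℝ :=
  sSup ((fun k : ℕ => 1 / (k : ℝ) ^ (1 + α) * (nuTilde F G k ^ 2 / (4 * c₁) + nu F G k 2)) ''
    Icc (ℓ + 1) n)

end Expansion

/-- `f` is a (real-valued) Radon-Nikodym density of the measure `μ` with respect to `G`; its
existence amounts, for finite measures, to `μ ≪ G`. -/
def IsDensity {𝔛 : Type*} [MeasurableSpace 𝔛] (μ G : Measure 𝔛) (f : 𝔛 → ℝ) : Prop :=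
  Measurable f ∧ (∀ᵐ x ∂G, 0 ≤ f x) ∧ μ = G.withDensity fun x => ENNReal.ofReal (f x)

/-- `‖V|_B‖ + |V(B)|`. -/
noncomputable def restrTerm {𝔛 : Type*} [MeasurableSpace 𝔛] (V : SignedMeasure 𝔛) (B : Set 𝔛) :
    ℝ :=
  tvNorm (V.restrict B) + |V B|

/-- `(∫_{Bᶜ} (f - 1)² dG)^{1/2}`, possibly infinite. -/
noncomputable def l2Term {𝔛 : Type*} [MeasurableSpace 𝔛] (G : Measure 𝔛) (f : 𝔛 → ℝ)
    (B : Set 𝔛) : ℝ≥0∞ :=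
  (∫⁻ x in Bᶜ, ENNReal.ofReal ((f x - 1) ^ 2) ∂G) ^ (1 / 2 : ℝ)

end ConvExpansion

/-! Expanding `∏ ((F j - G) + G)` shows that the error is the tail `∑_{k>ℓ} V_k G^{n-k}`. In the
`k`-th term each of the `k` factors `F j - G` absorbs `⌊(n-k)/k⌋` copies of `G`, and the leftover
power of `G` has norm at most 1. What remains is the `k`-th elementary symmetric polynomial in `x_j
= M_{j,k}`.

Kerstan's method bounds it (`apply_esymm_le`). It is the coefficient of `X^k` in `∏ (1 + x_j X) =
e^{aX} ∏ (1 + x_j X) e^{-x_j X}` with `a = ∑ x_j`. In the weighted `ℓ¹`-norm of radius `r`, which is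
submultiplicative, each factor `(1 + x X) e^{-xX}` has norm at most `2 - (1 - t) e^t ≤ exp(c₁ t²)`,
`t = ‖x‖ r`. The factor `e^{aX}` only needs its largest weighted coefficient, at most `exp((‖a‖
r)²/4)`. Optimising `r` gives `(2 e c₁ s_k / k)^{k/2}`, where `s_k = ν̃_k²/(4c₁) + ν_{k,2}`. Summing
over `k > ℓ` is a negative binomial series (`sum_rpow_half_le`).

For (b), `F - G` is split into its restriction to `B`, a centred density with respect to `G`, and a
multiple of `G`. Convolving the centred density with `G^m` gains `1/√(m+1)`
(`tvNorm_withDensityᵥ_mul_pow_le`): the density may sit on any of `m + 1` independent coordinates,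
and the average over these positions has small variance. With `m = ⌊(n-k)/k⌋` this gain is at most
`√(2k/n)`, whose `√k` cancels the `1/√k` coming from `η`. -/

namespace ConvExpansion

/-! ### The constant `c₁`: finiteness and numerical value. -/

theorem one_le_two_sub_one_sub_mul_exp (x : ℝ) : 1 ≤ 2 - (1 - x) * Real.exp x := by
  have h1 : 1 - x ≤ Real.exp (-x) := by linarith [Real.add_one_le_exp (-x)]
  have h2 := mul_le_mul_of_nonneg_right h1 (Real.exp_pos x).le
  rw [← Real.exp_add] at h2
  simp at h2
  linarith

/-- The auxiliary function `φ(x) = 2 e⁻ˣ - (1 - x)`. -/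
noncomputable def phi (x : ℝ) : ℝ := 2 * Real.exp (-x) - (1 - x)

theorem phi_pos (x : ℝ) : 0 < phi x := by
  have h1 := Real.add_one_le_exp (-x)
  have := Real.exp_pos (-x)
  unfold phi; linarith

theorem two_sub_eq_exp_mul_phi (x : ℝ) :
    2 - (1 - x) * Real.exp x = Real.exp x * phi x := by
  unfold phi
  have : Real.exp x * Real.exp (-x) = 1 := by rw [← Real.exp_add]; simp
  linear_combination -2 * this

theorem hasDerivAt_phi (x : ℝ) : HasDerivAt phi (1 - 2 * Real.exp (-x)) x := by
  have h := (((hasDerivAt_neg x).exp).const_mul 2).sub ((hasDerivAt_id x).const_sub 1)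
  refine h.congr_deriv ?_
  simp; ring

theorem continuous_phi : Continuous phi := by unfold phi; fun_prop

theorem antitoneOn_phi : AntitoneOn phi (Iic (Real.log 2)) := by
  refine antitoneOn_of_deriv_nonpos (convex_Iic _) continuous_phi.continuousOn
    (fun x _ => (hasDerivAt_phi x).differentiableAt.differentiableWithinAt) fun x hx => ?_
  rw [interior_Iic, mem_Iio] at hx
  rw [(hasDerivAt_phi x).deriv]
  have h := Real.exp_le_exp.2 (neg_le_neg hx.le)
  rw [Real.exp_neg (Real.log 2), Real.exp_log two_pos] at h
  linarith

theorem monotoneOn_phi : MonotoneOn phi (Ici (Real.log 2)) := by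
  refine monotoneOn_of_deriv_nonneg (convex_Ici _) continuous_phi.continuousOn
    (fun x _ => (hasDerivAt_phi x).differentiableAt.differentiableWithinAt) fun x hx => ?_
  rw [interior_Ici, mem_Ioi] at hx
  rw [(hasDerivAt_phi x).deriv]
  have h := Real.exp_le_exp.2 (neg_le_neg hx.le)
  rw [Real.exp_neg (Real.log 2), Real.exp_log two_pos] at h
  linarith

/-- The difference `ln (2 - (1 - x) eˣ) - c x²`. -/
noncomputable def logGap (c x : ℝ) : ℝ := Real.log (2 - (1 - x) * Real.exp x) - c * x ^ 2

theorem logGap_zero (c : ℝ) : logGap c 0 = 0 := by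
  simp only [logGap]; norm_num

/-- The factor `eˣ` cancels, so for `x > 0` the sign of the derivative depends only on whether `phi
x` is below or above `1 / (2c)`. As `phi` falls up to `ln 2` and rises afterwards, `logGap c` can
increase only on one interval. -/
theorem hasDerivAt_logGap (c x : ℝ) :
    HasDerivAt (logGap c) (x * (1 / phi x - 2 * c)) x := by
  have h0 : HasDerivAt (fun x : ℝ => 2 - (1 - x) * Real.exp x) (x * Real.exp x) x := by
    have h := ((((hasDerivAt_id x).const_sub 1).mul (Real.hasDerivAt_exp x))).const_sub 2
    refine h.congr_deriv ?_
    simp only [id]; ring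
  have hp : 2 - (1 - x) * Real.exp x ≠ 0 :=
    (one_pos.trans_le (one_le_two_sub_one_sub_mul_exp x)).ne'
  have h := (h0.log hp).sub (((hasDerivAt_id x).pow 2).const_mul c)
  refine h.congr_deriv ?_
  rw [two_sub_eq_exp_mul_phi]
  have := (phi_pos x).ne'
  have := (Real.exp_pos x).ne'
  simp only [id]
  field_simp
  ring

theorem continuous_logGap (c : ℝ) : Continuous (logGap c) :=
  continuous_iff_continuousAt.2 fun x => (hasDerivAt_logGap c x).continuousAt

theorem logGap_antitoneOn {c a b : ℝ} (ha : 0 ≤ a) (hc : 0 < c)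
    (h : ∀ x ∈ Ioo a b, 1 / (2 * c) ≤ phi x) : AntitoneOn (logGap c) (Icc a b) := by
  refine antitoneOn_of_deriv_nonpos (convex_Icc _ _) (continuous_logGap c).continuousOn
    (fun x _ => (hasDerivAt_logGap c x).differentiableAt.differentiableWithinAt) fun x hx => ?_
  rw [interior_Icc] at hx
  rw [(hasDerivAt_logGap c x).deriv]
  have h1 := h x hx
  rw [one_div_le (by positivity) (phi_pos x)] at h1
  exact mul_nonpos_of_nonneg_of_nonpos (ha.trans hx.1.le) (by linarith)

theorem logGap_monotoneOn {c a b : ℝ} (ha : 0 ≤ a) (hc : 0 < c)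
    (h : ∀ x ∈ Ioo a b, phi x ≤ 1 / (2 * c)) : MonotoneOn (logGap c) (Icc a b) := by
  refine monotoneOn_of_deriv_nonneg (convex_Icc _ _) (continuous_logGap c).continuousOn
    (fun x _ => (hasDerivAt_logGap c x).differentiableAt.differentiableWithinAt) fun x hx => ?_
  rw [interior_Icc] at hx
  rw [(hasDerivAt_logGap c x).deriv]
  have h1 := h x hx
  rw [le_one_div (phi_pos x) (by positivity)] at h1
  exact mul_nonneg (ha.trans hx.1.le) (by linarith)

/-- A bound for the maximum of `logGap c`, once its location is known up to `b - a`. -/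
theorem logGap_nonpos {c a b δ : ℝ} (hc : 0 < c) (ha : Real.log 2 ≤ a) (hab : a ≤ b)
    (hpa : phi a ≤ 1 / (2 * c)) (hpb : 1 / (2 * c) ≤ phi b) (hδ : 0 ≤ δ)
    (hpa' : 1 / phi a ≤ 2 * c + δ) (hga : logGap c a + b * δ * (b - a) ≤ 0)
    {x : ℝ} (hx : 0 ≤ x) : logGap c x ≤ 0 := by
  have hl : 0 < Real.log 2 := Real.log_pos one_lt_two
  have ha0 : 0 < a := hl.trans_le ha
  have hga0 : logGap c a ≤ 0 := by
    have : 0 ≤ b * δ * (b - a) :=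
      mul_nonneg (mul_nonneg (ha0.le.trans hab) hδ) (by linarith)
    linarith
  -- The maximiser lies in `[a, b]`. There `phi ≥ phi a` keeps the derivative below `b δ`, so the
  -- mean value inequality adds at most `b δ (b - a)` to `logGap c a`.
  have hmid : ∀ y ∈ Icc a b, logGap c y ≤ 0 := by
    intro y hy
    have hd : ∀ z ∈ interior (Icc a y), deriv (logGap c) z ≤ b * δ := by
      intro z hz
      rw [interior_Icc] at hz
      rw [(hasDerivAt_logGap c z).deriv]
      have h1 : phi a ≤ phi z := monotoneOn_phi ha (ha.trans hz.1.le) hz.1.le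
      have h2 := one_div_le_one_div_of_le (phi_pos a) h1
      have h3 : 0 ≤ z := ha0.le.trans hz.1.le
      calc z * (1 / phi z - 2 * c) ≤ z * δ := mul_le_mul_of_nonneg_left (by linarith) h3
        _ ≤ b * δ := mul_le_mul_of_nonneg_right (hz.2.le.trans hy.2) hδ
    have := (convex_Icc a y).image_sub_le_mul_sub_of_deriv_le (f := logGap c)
      (continuous_logGap c).continuousOn
      (fun x _ => (hasDerivAt_logGap c x).differentiableAt.differentiableWithinAt) hd
      a (left_mem_Icc.2 hy.1) y (right_mem_Icc.2 hy.1) hy.1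
    have h4 : b * δ * (y - a) ≤ b * δ * (b - a) :=
      mul_le_mul_of_nonneg_left (by linarith [hy.2]) (mul_nonneg (ha0.le.trans hab) hδ)
    linarith
  rcases le_total b x with hbx | hxb
  · have h := logGap_antitoneOn (a := b) (b := x) (ha0.le.trans hab) hc (fun y hy =>
      hpb.trans (monotoneOn_phi (ha.trans hab) ((ha.trans hab).trans hy.1.le) hy.1.le))
    exact (h (left_mem_Icc.2 hbx) (right_mem_Icc.2 hbx) hbx).trans
      (hmid b (right_mem_Icc.2 hab))
  rcases le_total a x with hax | hxa
  · exact hmid x ⟨hax, hxb⟩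
  -- Left of `a`: if `phi x` is below the level, it stays below on `[x, a]` and `logGap c` climbs to
  -- its value at `a`; otherwise, for `x ≤ ln 2`, it has only decreased from its value 0 at the
  -- origin.
  rcases le_total (phi x) (1 / (2 * c)) with hp | hp
  · have h := logGap_monotoneOn (a := x) (b := a) hx hc (fun y hy => by
      rcases le_total y (Real.log 2) with hy2 | hy2
      · exact (antitoneOn_phi (hy.1.le.trans hy2) hy2 hy.1.le).trans hp
      · exact (monotoneOn_phi hy2 ha hy.2.le).trans hpa)
    exact (h (left_mem_Icc.2 hxa) (right_mem_Icc.2 hxa) hxa).trans hga0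
  · rcases le_total x (Real.log 2) with hxl | hxl
    · have h := logGap_antitoneOn (a := 0) (b := x) le_rfl hc (fun y hy =>
        hp.trans (antitoneOn_phi (hy.2.le.trans hxl) hxl hy.2.le))
      exact (h (left_mem_Icc.2 hx) (right_mem_Icc.2 hx) hx).trans (logGap_zero c).le
    · have h1 : phi x = 1 / (2 * c) :=
        le_antisymm ((monotoneOn_phi hxl ha hxa).trans hpa) hp
      have h := logGap_monotoneOn (a := x) (b := a) hx hc (fun y hy =>
        (monotoneOn_phi (hxl.trans hy.1.le) ha hy.2.le).trans hpa)
      exact (h (left_mem_Icc.2 hxa) (right_mem_Icc.2 hxa) hxa).trans hga0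

/-- The constant is kept strictly below `0.694026` so that the supremum inherits a strict bound. The
interval `[0.9362, 0.9363]` brackets the point where `phi` crosses `1 / (2c)` upwards. -/
theorem log_two_sub_le {x : ℝ} (hx : 0 ≤ x) :
    Real.log (2 - (1 - x) * Real.exp x) ≤ 0.6940259 * x ^ 2 := by
  have e1 : Real.exp 0.9362 ≤ 2.5502719487 := by
    refine (Real.exp_bound' (x := 0.9362) (by norm_num) (by norm_num) (n := 15)
      (by norm_num)).trans ?_
    norm_num [Finset.sum_range_succ, Nat.factorial]
  have e2 : 2.5502719484 ≤ Real.exp 0.9362 := by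
    refine le_trans ?_ (Real.sum_le_exp_of_nonneg (x := 0.9362) (by norm_num) 15)
    norm_num [Finset.sum_range_succ, Nat.factorial]
  have e3 : Real.exp 0.9363 ≤ 2.550527 := by
    refine (Real.exp_bound' (x := 0.9363) (by norm_num) (by norm_num) (n := 15)
      (by norm_num)).trans ?_
    norm_num [Finset.sum_range_succ, Nat.factorial]
  have e4 : 1.8372927 ≤ Real.exp 0.608293184 := by
    refine le_trans ?_ (Real.sum_le_exp_of_nonneg (x := 0.608293184) (by norm_num) 14)
    norm_num [Finset.sum_range_succ, Nat.factorial]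
  have hp1 : phi 0.9362 ≤ 0.7204300902 := by
    have h := inv_anti₀ (by norm_num) e2
    rw [phi, Real.exp_neg]
    norm_num at h ⊢
    linarith
  have hp2 : 0.72043009 ≤ phi 0.9362 := by
    have h := inv_anti₀ (Real.exp_pos _) e1
    rw [phi, Real.exp_neg]
    norm_num at h ⊢
    linarith
  have hp3 : 0.72045166 ≤ phi 0.9363 := by
    have h := inv_anti₀ (Real.exp_pos _) e3
    rw [phi, Real.exp_neg]
    norm_num at h ⊢
    linarith
  have hg : logGap 0.6940259 0.9362 ≤ -1.5e-9 := by
    have h1 : Real.log (2 - (1 - 0.9362) * Real.exp 0.9362) ≤ 0.608293184 := by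
      rw [Real.log_le_iff_le_exp (by linarith [one_le_two_sub_one_sub_mul_exp 0.9362])]
      norm_num at e1 e2 e4 ⊢
      linarith
    rw [logGap]
    norm_num at h1 ⊢
    linarith
  -- Here `b δ (b - a)` is about `0.94e-9`, which the margin `1.5e-9` at `a` absorbs.
  have := logGap_nonpos (c := 0.6940259) (a := 0.9362) (b := 0.9363) (δ := 1e-5) (by norm_num)
    (by linarith [Real.log_two_lt_d9]) (by norm_num) (hp1.trans (by norm_num))
    (le_trans (by norm_num) hp3) (by norm_num)
    ((one_div_le_one_div_of_le (by norm_num) hp2).trans (by norm_num))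
    (by norm_num at hg ⊢; linarith) hx
  rw [logGap] at this
  linarith

/-- The point `0.936` is close enough to the maximiser of `h₁` to give six decimals. -/
theorem le_h₁ : 0.694025 ≤ h₁ 0.936 := by
  have e1 : Real.exp 0.936 ≤ 2.54977 := by
    refine (Real.exp_bound' (x := 0.936) (by norm_num) (by norm_num) (n := 13)
      (by norm_num)).trans ?_
    norm_num [Finset.sum_range_succ, Nat.factorial]
  have e2 : Real.exp 0.608032527 ≤ 1.836814 := by
    refine (Real.exp_bound' (x := 0.608032527) (by norm_num) (by norm_num) (n := 12)
      (by norm_num)).trans ?_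
    norm_num [Finset.sum_range_succ, Nat.factorial]
  rw [h₁, le_div_iff₀ (by norm_num),
    Real.le_log_iff_exp_le (by linarith [one_le_two_sub_one_sub_mul_exp 0.936])]
  refine (Real.exp_le_exp.2 (by norm_num)).trans (e2.trans ?_)
  norm_num at e1 ⊢
  linarith

theorem h₁_le {x : ℝ} (hx : 0 < x) : h₁ x ≤ 0.6940259 := by
  rw [h₁, div_le_iff₀ (by positivity)]
  exact log_two_sub_le hx.le

theorem bddAbove_h₁ : BddAbove (h₁ '' Ioi 0) :=
  ⟨0.6940259, by rintro _ ⟨x, hx, rfl⟩; exact h₁_le hx⟩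

theorem isLUB_c₁ : IsLUB (h₁ '' Ioi 0) c₁ :=
  isLUB_csSup ⟨_, 1, mem_Ioi.2 one_pos, rfl⟩ bddAbove_h₁

theorem le_c₁ : 0.694025 ≤ c₁ :=
  le_h₁.trans (isLUB_c₁.1 ⟨0.936, by norm_num, rfl⟩)

theorem c₁_lt : c₁ < 0.694026 := by
  have h : c₁ ≤ 0.6940259 := isLUB_c₁.2 (by rintro _ ⟨x, hx, rfl⟩; exact h₁_le hx)
  exact h.trans_lt (by norm_num)

theorem c₁_pos : 0 < c₁ := lt_of_lt_of_le (by norm_num) le_c₁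

theorem two_sub_one_sub_mul_exp_le {x : ℝ} (hx : 0 ≤ x) :
    2 - (1 - x) * Real.exp x ≤ Real.exp (c₁ * x ^ 2) := by
  rcases hx.eq_or_lt with rfl | hx
  · norm_num
  have h : h₁ x ≤ c₁ := isLUB_c₁.1 ⟨x, hx, rfl⟩
  rw [h₁, div_le_iff₀ (by positivity)] at h
  exact (Real.log_le_iff_le_exp (by linarith [one_le_two_sub_one_sub_mul_exp x])).1 h

/-! ### The total variation norm as a seminorm. -/

section TotalVariation

variable {𝔛 : Type*} [MeasurableSpace 𝔛]

theorem tvNorm_eq (V : SignedMeasure 𝔛) :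
    tvNorm V = V.toJordanDecomposition.posPart.real univ
      + V.toJordanDecomposition.negPart.real univ := by
  rw [tvNorm, SignedMeasure.totalVariation, measureReal_add_apply]

theorem tvNorm_nonneg (V : SignedMeasure 𝔛) : 0 ≤ tvNorm V := measureReal_nonneg

theorem tvNorm_zero : tvNorm (0 : SignedMeasure 𝔛) = 0 := by
  simp [tvNorm, SignedMeasure.totalVariation_zero]

/-- A Hahn set attains the norm, so upper bounds for `tvNorm` reduce to evaluating `V` on one set
and its complement. -/
theorem exists_tvNorm_eq (V : SignedMeasure 𝔛) :
    ∃ A, MeasurableSet A ∧ tvNorm V = V A - V Aᶜ := by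
  obtain ⟨A, hA, hp, hn⟩ := V.toJordanDecomposition.mutuallySingular
  refine ⟨Aᶜ, hA.compl, ?_⟩
  rw [V.apply_eq_posPart_real_sub_negPart_real hA.compl,
    V.apply_eq_posPart_real_sub_negPart_real hA.compl.compl, tvNorm_eq, compl_compl,
    ← measureReal_add_measureReal_compl (μ := V.toJordanDecomposition.posPart) hA,
    ← measureReal_add_measureReal_compl (μ := V.toJordanDecomposition.negPart) hA,
    measureReal_def _ A, measureReal_def _ A, measureReal_def V.toJordanDecomposition.negPart Aᶜ,
    hp, hn]
  simp

/-- A difference of two finite measures has total variation norm at most the total mass. -/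
theorem tvNorm_sub_le (a b : Measure 𝔛) [IsFiniteMeasure a] [IsFiniteMeasure b] :
    tvNorm (a.toSignedMeasure - b.toSignedMeasure) ≤ a.real univ + b.real univ := by
  obtain ⟨A, hA, h⟩ := exists_tvNorm_eq (a.toSignedMeasure - b.toSignedMeasure)
  rw [h, Measure.toSignedMeasure_sub_apply hA, Measure.toSignedMeasure_sub_apply hA.compl,
    ← measureReal_add_measureReal_compl (μ := a) hA, ← measureReal_add_measureReal_compl (μ := b) hA]
  have h1 : 0 ≤ b.real A := measureReal_nonneg
  have h2 : 0 ≤ a.real Aᶜ := measureReal_nonneg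
  linarith

theorem tvNorm_toSignedMeasure_le (a : Measure 𝔛) [IsFiniteMeasure a] :
    tvNorm a.toSignedMeasure ≤ a.real univ := by
  simpa using tvNorm_sub_le a 0

theorem tvNorm_add_le (U V : SignedMeasure 𝔛) : tvNorm (U + V) ≤ tvNorm U + tvNorm V := by
  have h : U + V = (U.toJordanDecomposition.posPart
        + V.toJordanDecomposition.posPart).toSignedMeasure
      - (U.toJordanDecomposition.negPart + V.toJordanDecomposition.negPart).toSignedMeasure := by
    rw [Measure.toSignedMeasure_add, Measure.toSignedMeasure_add]
    conv_lhs => rw [eq_pos_sub_neg U, eq_pos_sub_neg V]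
    abel
  rw [h]
  refine (tvNorm_sub_le _ _).trans (le_of_eq ?_)
  rw [tvNorm_eq U, tvNorm_eq V, measureReal_add_apply, measureReal_add_apply]
  ring

theorem tvNorm_smul (c : ℝ) (V : SignedMeasure 𝔛) : tvNorm (c • V) = |c| * tvNorm V := by
  rw [tvNorm_eq, tvNorm_eq, SignedMeasure.toJordanDecomposition_smul_real]
  rcases le_or_gt 0 c with hc | hc
  · rw [JordanDecomposition.real_smul_posPart_nonneg _ _ hc,
      JordanDecomposition.real_smul_negPart_nonneg _ _ hc, measureReal_nnreal_smul_apply,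
      measureReal_nnreal_smul_apply, Real.coe_toNNReal _ hc, abs_of_nonneg hc]
    ring
  · rw [JordanDecomposition.real_smul_posPart_neg _ _ hc,
      JordanDecomposition.real_smul_negPart_neg _ _ hc, measureReal_nnreal_smul_apply,
      measureReal_nnreal_smul_apply, Real.coe_toNNReal _ (by linarith), abs_of_neg hc]
    ring

theorem tvNorm_sum_le {ι : Type*} (s : Finset ι) (V : ι → SignedMeasure 𝔛) :
    tvNorm (∑ i ∈ s, V i) ≤ ∑ i ∈ s, tvNorm (V i) :=
  Finset.le_sum_of_subadditive _ tvNorm_zero.le tvNorm_add_le s V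

theorem tvNorm_toSignedMeasure_le_one (G : Measure 𝔛) [IsProbabilityMeasure G] :
    tvNorm G.toSignedMeasure ≤ 1 :=
  (tvNorm_toSignedMeasure_le G).trans (by simp)

end TotalVariation

/-! ### Submultiplicativity under convolution. -/

section Group

variable {𝔛 : Type*} [AddCommGroup 𝔛] [MeasurableSpace 𝔛] [MeasurableSub₂ 𝔛]

theorem measureReal_conv_univ (a b : Measure 𝔛) [IsFiniteMeasure a] [IsFiniteMeasure b] :
    (a.conv b).real univ = a.real univ * b.real univ := by
  have : MeasurableAdd₂ 𝔛 := measurableAdd₂_of_sub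
  rw [Measure.conv, map_measureReal_apply measurable_add MeasurableSet.univ, preimage_univ,
    ← univ_prod_univ, measureReal_prod_prod]

theorem mul_def (U V : SignedMeasure 𝔛) : U * V = sconv U V := rfl

theorem one_def : (1 : SignedMeasure 𝔛) = (Measure.dirac (0 : 𝔛)).toSignedMeasure := rfl

theorem tvNorm_mul_le (U V : SignedMeasure 𝔛) : tvNorm (U * V) ≤ tvNorm U * tvNorm V := by
  have h := sconv_sub_sub' U.toJordanDecomposition.posPart U.toJordanDecomposition.negPart
    V.toJordanDecomposition.posPart V.toJordanDecomposition.negPart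
  rw [← eq_pos_sub_neg, ← eq_pos_sub_neg] at h
  rw [mul_def, h]
  refine (tvNorm_sub_le _ _).trans (le_of_eq ?_)
  rw [tvNorm_eq U, tvNorm_eq V, measureReal_add_apply, measureReal_add_apply]
  simp only [measureReal_conv_univ]
  ring

theorem tvNorm_one_le : tvNorm (1 : SignedMeasure 𝔛) ≤ 1 := by
  rw [one_def]
  exact (tvNorm_toSignedMeasure_le _).trans (by simp)

theorem tvNorm_pow_le_one {V : SignedMeasure 𝔛} (h : tvNorm V ≤ 1) (m : ℕ) :
    tvNorm (V ^ m) ≤ 1 := by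
  induction m with
  | zero => simpa using tvNorm_one_le
  | succ m ih =>
    rw [pow_succ]
    exact (tvNorm_mul_le _ _).trans (mul_le_one₀ ih (tvNorm_nonneg _) h)

theorem mul_toSignedMeasure (μ ν : Measure 𝔛) [IsFiniteMeasure μ] [IsFiniteMeasure ν] :
    μ.toSignedMeasure * ν.toSignedMeasure = (μ.conv ν).toSignedMeasure :=
  sconv_toSignedMeasure μ ν

end Group

/-- Rational scalars, restricted from the real ones, serve to form `PowerSeries.exp` over the
convolution ring. -/
noncomputable instance instModuleRatSignedMeasure {𝔛 : Type*} [MeasurableSpace 𝔛] :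
    Module ℚ (SignedMeasure 𝔛) := Module.compHom _ (algebraMap ℚ ℝ)

theorem tvNorm_rat_smul {𝔛 : Type*} [MeasurableSpace 𝔛] (q : ℚ) (V : SignedMeasure 𝔛) :
    tvNorm (q • V) = |(q : ℝ)| * tvNorm V := tvNorm_smul (q : ℝ) V

noncomputable instance instAlgebraRatSignedMeasure {𝔛 : Type*} [AddCommGroup 𝔛]
    [MeasurableSpace 𝔛] [MeasurableSub₂ 𝔛] : Algebra ℚ (SignedMeasure 𝔛) :=
  Algebra.ofModule
    (fun q U V => map_rat_smul (AddMonoidHom.mulRight V) q U)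
    (fun q U V => map_rat_smul (AddMonoidHom.mulLeft U) q V)

/-! ### Scalar inequalities behind Kerstan's bound. -/

section Scalar

/-- `tⁱ / i! ≤ exp (t² / 4)`. -/
theorem pow_div_factorial_le_exp {t : ℝ} (ht : 0 ≤ t) (i : ℕ) :
    t ^ i / i.factorial ≤ Real.exp (t ^ 2 / 4) := by
  -- This is the claim, squared, at `t² = 2i`, where `tⁱ exp(-t²/4)` is largest. The induction uses
  -- `(1 + 1/i)^i ≤ e` and `2 ≤ i + 1`.
  have key : ∀ i : ℕ, (2 * i : ℝ) ^ i ≤ Real.exp i * (i.factorial : ℝ) ^ 2 := by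
    intro i
    induction i with
    | zero => simp
    | succ i ih =>
      rcases Nat.eq_zero_or_pos i with rfl | hi
      · have := Real.exp_one_gt_d9
        norm_num
        linarith
      have hi' : (1 : ℝ) ≤ i := by exact_mod_cast hi
      have h1 : ((i : ℝ) + 1) ^ i ≤ (i : ℝ) ^ i * Real.exp 1 := by
        have h := Real.add_one_le_exp (1 / (i : ℝ))
        have h2 : ((1 / (i : ℝ)) + 1) ^ i ≤ Real.exp 1 := by
          calc ((1 / (i : ℝ)) + 1) ^ i ≤ Real.exp (1 / i) ^ i := by gcongr
            _ = Real.exp 1 := by rw [← Real.exp_nat_mul]; congr 1; field_simp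
        calc ((i : ℝ) + 1) ^ i = (i : ℝ) ^ i * (1 / (i : ℝ) + 1) ^ i := by
              rw [← mul_pow]; congr 1; field_simp; ring
          _ ≤ _ := by gcongr
      push_cast [Nat.factorial_succ]
      calc (2 * ((i : ℝ) + 1)) ^ (i + 1)
          = 2 * (i + 1) * (2 ^ i * (i + 1) ^ i) := by rw [pow_succ, mul_pow]; ring
        _ ≤ 2 * (i + 1) * (2 ^ i * (i ^ i * Real.exp 1)) := by gcongr
        _ = 2 * (i + 1) * (2 * i) ^ i * Real.exp 1 := by rw [mul_pow]; ring
        _ ≤ 2 * (i + 1) * (Real.exp i * (i.factorial : ℝ) ^ 2) * Real.exp 1 := by gcongr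
        _ ≤ (i + 1) * (i + 1) * (Real.exp i * (i.factorial : ℝ) ^ 2) * Real.exp 1 := by
            gcongr; linarith
        _ = Real.exp (i + 1) * ((i + 1) * i.factorial) ^ 2 := by rw [Real.exp_add]; ring
  rcases Nat.eq_zero_or_pos i with rfl | hi
  · simpa using Real.one_le_exp (by positivity : 0 ≤ t ^ 2 / 4)
  have hi' : (0 : ℝ) < i := by exact_mod_cast hi
  rw [div_le_iff₀ (by positivity), ← pow_le_pow_iff_left₀ (by positivity) (by positivity)
    two_ne_zero]
  -- The inequality `u ≤ e^{u-1}`, with equality at the maximiser `u = 1`, reduces general `t` to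
  -- `key`.
  have h1 : t ^ 2 / (2 * i) ≤ Real.exp (t ^ 2 / (2 * i) - 1) := by
    linarith [Real.add_one_le_exp (t ^ 2 / (2 * i) - 1)]
  have h2 : (t ^ 2) ^ i ≤ (2 * i : ℝ) ^ i * Real.exp (t ^ 2 / 2 - i) := by
    calc (t ^ 2) ^ i = (2 * i : ℝ) ^ i * (t ^ 2 / (2 * i)) ^ i := by
          rw [← mul_pow]; congr 1; field_simp
      _ ≤ (2 * i : ℝ) ^ i * Real.exp (t ^ 2 / (2 * i) - 1) ^ i := by gcongr
      _ = _ := by rw [← Real.exp_nat_mul]; congr 2; field_simp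
  calc (t ^ i) ^ 2 = (t ^ 2) ^ i := by ring
    _ ≤ (2 * i : ℝ) ^ i * Real.exp (t ^ 2 / 2 - i) := h2
    _ ≤ Real.exp i * (i.factorial : ℝ) ^ 2 * Real.exp (t ^ 2 / 2 - i) := by gcongr; exact key i
    _ = (Real.exp (t ^ 2 / 4) * i.factorial) ^ 2 := by
        rw [mul_pow, ← Real.exp_nat_mul, mul_right_comm, ← Real.exp_add]
        congr 2; push_cast; ring

/-- The partial sums of the majorant of `(1 + x) e⁻ˣ`. -/
theorem sum_sub_one_div_factorial_le {x : ℝ} (hx : 0 ≤ x) (K : ℕ) :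
    ∑ m ∈ Finset.range K, |1 - (m : ℝ)| / m.factorial * x ^ m ≤ 2 - (1 - x) * Real.exp x := by
  have h1 : HasSum (fun m : ℕ => x ^ m / m.factorial) (Real.exp x) := by
    rw [Real.exp_eq_exp_ℝ]; exact NormedSpace.expSeries_div_hasSum_exp x
  have h2 : HasSum (fun m : ℕ => (m : ℝ) * (x ^ m / m.factorial)) (x * Real.exp x) := by
    rw [← hasSum_nat_add_iff' 1]
    simp only [Finset.sum_range_one, Nat.cast_zero, zero_mul, sub_zero]
    convert! h1.mul_left x using 1
    funext m
    push_cast [Nat.factorial_succ]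
    field_simp
    ring
  have h3 : HasSum (fun m : ℕ => |1 - (m : ℝ)| / m.factorial * x ^ m)
      (2 - (1 - x) * Real.exp x) := by
    -- `|1 - m|` equals `m - 1` except at `m = 0`, where it is larger by 2.
    have h4 : HasSum (fun m : ℕ => if m = 0 then (2 : ℝ) else 0) 2 := hasSum_ite_eq 0 2
    have h5 := (h4.add h2).sub h1
    have h6 : 2 + x * Real.exp x - Real.exp x = 2 - (1 - x) * Real.exp x := by ring
    rw [h6] at h5
    refine h5.congr_fun fun m => ?_
    rcases m with _ | m
    · norm_num
    · push_cast
      rw [abs_of_nonpos (by linarith [(Nat.cast_nonneg m : (0:ℝ) ≤ m)])]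
      simp; ring
  exact sum_le_hasSum _ (fun m _ => by positivity) h3

end Scalar

/-! ### Weighted `ℓ¹`-norms of power series and Kerstan's bound, for an abstract submultiplicative
`N`. -/

section PowerSeries

open PowerSeries

variable {R : Type*} [CommRing R] {N : R → ℝ}

/-- The partial sums of the weighted `ℓ¹`-norm of a power series, with respect to `N` on the
coefficients and the radius `r`, are at most `u`. -/
def WeightedLE (N : R → ℝ) (r : ℝ) (f : R⟦X⟧) (u : ℝ) : Prop :=
  ∀ K, ∑ m ∈ Finset.range K, N (coeff m f) * r ^ m ≤ u

/-- The Cauchy product: the index triangle `p.1 + p.2 < K` lies in the square over which the product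
of two partial sums runs. -/
theorem WeightedLE.mul (h0 : ∀ x, 0 ≤ N x) (hz : N 0 = 0) (hadd : ∀ x y, N (x + y) ≤ N x + N y)
    (hmul : ∀ x y, N (x * y) ≤ N x * N y) {r : ℝ} (hr : 0 ≤ r) {f g : R⟦X⟧} {u v : ℝ}
    (hf : WeightedLE N r f u) (hg : WeightedLE N r g v) : WeightedLE N r (f * g) (u * v) := by
  intro K
  have hu : 0 ≤ u := by simpa using hf 0
  calc ∑ m ∈ Finset.range K, N (coeff m (f * g)) * r ^ m
      ≤ ∑ m ∈ Finset.range K, ∑ p ∈ Finset.HasAntidiagonal.antidiagonal m,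
          (N (coeff p.1 f) * r ^ p.1) * (N (coeff p.2 g) * r ^ p.2) := by
        refine Finset.sum_le_sum fun m _ => ?_
        rw [coeff_mul]
        have h1 := Finset.le_sum_of_subadditive N hz.le hadd (Finset.HasAntidiagonal.antidiagonal m)
          (fun p => coeff p.1 f * coeff p.2 g)
        refine (mul_le_mul_of_nonneg_right h1 (by positivity)).trans ?_
        rw [Finset.sum_mul]
        refine Finset.sum_le_sum fun p hp => ?_
        rw [← Finset.HasAntidiagonal.mem_antidiagonal.1 hp, pow_add]
        refine (mul_le_mul_of_nonneg_right (hmul _ _) (by positivity)).trans (le_of_eq (by ring))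
    _ = ∑ p ∈ (Finset.range K ×ˢ Finset.range K) with p.1 + p.2 < K,
          (N (coeff p.1 f) * r ^ p.1) * (N (coeff p.2 g) * r ^ p.2) := by
        rw [Finset.sum_sigma']
        refine Finset.sum_nbij' (fun x => x.2) (fun p => ⟨p.1 + p.2, p⟩) ?_ ?_ ?_ ?_ ?_
        · rintro ⟨m, p, q⟩ h; simp at h ⊢; omega
        · rintro ⟨p, q⟩ h; simp at h ⊢; omega
        · rintro ⟨m, p, q⟩ h; simp at h ⊢; omega
        · rintro ⟨p, q⟩ h; simp
        · rintro ⟨m, p, q⟩ h; simp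
    _ ≤ ∑ p ∈ (Finset.range K ×ˢ Finset.range K),
          (N (coeff p.1 f) * r ^ p.1) * (N (coeff p.2 g) * r ^ p.2) := by
        refine Finset.sum_le_sum_of_subset_of_nonneg (Finset.filter_subset _ _) fun p _ _ => ?_
        exact mul_nonneg (mul_nonneg (h0 _) (by positivity)) (mul_nonneg (h0 _) (by positivity))
    _ = (∑ m ∈ Finset.range K, N (coeff m f) * r ^ m) *
          ∑ m ∈ Finset.range K, N (coeff m g) * r ^ m := by
        rw [Finset.sum_mul_sum, Finset.sum_product]
    _ ≤ u * v := mul_le_mul (hf K) (hg K)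
        (Finset.sum_nonneg fun m _ => mul_nonneg (h0 _) (by positivity)) hu

theorem WeightedLE.one (hz : N 0 = 0) (h1 : N 1 ≤ 1) (r : ℝ) : WeightedLE N r (1 : R⟦X⟧) 1 := by
  intro K
  calc ∑ m ∈ Finset.range K, N (coeff m (1 : R⟦X⟧)) * r ^ m
      = ∑ m ∈ Finset.range K, if m = 0 then N 1 else 0 := by
        refine Finset.sum_congr rfl fun m _ => ?_
        rw [coeff_one]; split_ifs with h <;> simp [h, hz]
    _ ≤ 1 := by
        rw [Finset.sum_ite_eq']
        split_ifs
        · exact h1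
        · exact zero_le_one

theorem WeightedLE.prod (h0 : ∀ x, 0 ≤ N x) (hz : N 0 = 0) (h1 : N 1 ≤ 1)
    (hadd : ∀ x y, N (x + y) ≤ N x + N y)
    (hmul : ∀ x y, N (x * y) ≤ N x * N y) {r : ℝ} (hr : 0 ≤ r) {ι : Type*} (s : Finset ι)
    {f : ι → R⟦X⟧} {u : ι → ℝ} (hf : ∀ i ∈ s, WeightedLE N r (f i) (u i)) :
    WeightedLE N r (∏ i ∈ s, f i) (∏ i ∈ s, u i) := by
  classical
  induction s using Finset.induction_on with
  | empty => simpa using WeightedLE.one hz h1 r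
  | insert a s ha ih =>
    rw [Finset.prod_insert ha, Finset.prod_insert ha]
    exact WeightedLE.mul h0 hz hadd hmul hr (hf a (Finset.mem_insert_self _ _))
      (ih fun i hi => hf i (Finset.mem_insert_of_mem hi))

theorem apply_pow_le (h0 : ∀ x, 0 ≤ N x) (h1 : N 1 ≤ 1) (hmul : ∀ x y, N (x * y) ≤ N x * N y)
    (x : R) (m : ℕ) : N (x ^ m) ≤ N x ^ m := by
  induction m with
  | zero => simpa using h1
  | succ m ih =>
    rw [pow_succ, pow_succ]
    exact (hmul _ _).trans (mul_le_mul_of_nonneg_right ih (h0 _))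

theorem coeff_prod_one_add_C_mul_X {ι : Type*} (s : Finset ι) (x : ι → R) (k : ℕ) :
    coeff k (∏ i ∈ s, (1 + C (x i) * X)) = ∑ J ∈ s.powersetCard k, ∏ j ∈ J, x j := by
  classical
  rw [Finset.prod_one_add]
  simp only [Finset.prod_mul_distrib, Finset.prod_const, map_sum, ← map_prod, coeff_C_mul_X_pow]
  rw [Finset.powersetCard_eq_filter, Finset.sum_filter]
  exact Finset.sum_congr rfl fun J _ => by simp only [eq_comm]

variable [Algebra ℚ R]

theorem prod_rescale_exp {ι : Type*} (s : Finset ι) (x : ι → R) :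
    ∏ i ∈ s, rescale (x i) (exp R) = rescale (∑ i ∈ s, x i) (exp R) := by
  classical
  induction s using Finset.induction_on with
  | empty => simp [rescale_zero, constantCoeff_exp]
  | insert a s ha ih =>
    rw [Finset.prod_insert ha, Finset.sum_insert ha, ih, exp_mul_exp_eq_exp_add]

theorem rescale_exp_mul_rescale_neg_exp (x : R) :
    rescale x (exp R) * rescale (-x) (exp R) = 1 := by
  rw [exp_mul_exp_eq_exp_add]; simp [rescale_zero, constantCoeff_exp]

/-- The coefficient at `m = 1` vanishes; this is why the norm of the factor admits a bound `exp(c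
t²)` without a linear term. -/
theorem coeff_one_add_mul_rescale_exp (x : R) (m : ℕ) :
    coeff m ((1 + C x * X) * rescale (-x) (exp R)) =
      algebraMap ℚ R ((1 - m) * (-1) ^ m / m.factorial) * x ^ m := by
  rcases m with _ | m
  · rw [coeff_zero_eq_constantCoeff_apply, map_mul, ← coeff_zero_eq_constantCoeff_apply _,
      ← coeff_zero_eq_constantCoeff_apply _, coeff_rescale, coeff_exp]
    simp
  rw [add_mul, one_mul, map_add, mul_assoc, coeff_C_mul, coeff_succ_X_mul, coeff_rescale,
    coeff_rescale, coeff_exp, coeff_exp]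
  have h : ((1 - ((m + 1 : ℕ) : ℚ)) * (-1) ^ (m + 1) / (m + 1).factorial)
      = (-1) ^ (m + 1) * (1 / (m + 1).factorial) + (-1) ^ m * (1 / m.factorial) := by
    push_cast [Nat.factorial_succ]
    field_simp
    ring
  rw [h, map_add, map_mul, map_mul, neg_pow x (m + 1), neg_pow x m]
  simp
  ring

theorem apply_algebraMap_mul_pow_le (h0 : ∀ x, 0 ≤ N x) (h1 : N 1 ≤ 1)
    (hmul : ∀ x y, N (x * y) ≤ N x * N y) (hq : ∀ q x, N (algebraMap ℚ R q * x) ≤ |(q : ℝ)| * N x)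
    (q : ℚ) (x : R) (m : ℕ) : N (algebraMap ℚ R q * x ^ m) ≤ |(q : ℝ)| * N x ^ m :=
  (hq _ _).trans (mul_le_mul_of_nonneg_left (apply_pow_le h0 h1 hmul x m) (abs_nonneg _))

theorem weightedLE_one_add_mul_rescale_exp (h0 : ∀ x, 0 ≤ N x) (h1 : N 1 ≤ 1)
    (hmul : ∀ x y, N (x * y) ≤ N x * N y) (hq : ∀ q x, N (algebraMap ℚ R q * x) ≤ |(q : ℝ)| * N x)
    {r : ℝ} (hr : 0 ≤ r) (x : R) :
    WeightedLE N r ((1 + C x * X) * rescale (-x) (exp R)) (Real.exp (c₁ * (N x * r) ^ 2)) := by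
  intro K
  have hx : 0 ≤ N x * r := mul_nonneg (h0 x) hr
  refine le_trans (Finset.sum_le_sum fun m _ => ?_)
    ((sum_sub_one_div_factorial_le hx K).trans (two_sub_one_sub_mul_exp_le hx))
  rw [coeff_one_add_mul_rescale_exp, mul_pow, ← mul_assoc]
  refine mul_le_mul_of_nonneg_right ((apply_algebraMap_mul_pow_le h0 h1 hmul hq _ _ _).trans
    (le_of_eq ?_)) (by positivity)
  push_cast
  rw [abs_div, abs_mul, abs_pow, abs_neg, abs_one, one_pow, mul_one, Nat.abs_cast]

/-- Kerstan's bound, before optimisation of the radius. -/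
theorem apply_coeff_prod_mul_pow_le (h0 : ∀ x, 0 ≤ N x) (hz : N 0 = 0) (h1 : N 1 ≤ 1)
    (hadd : ∀ x y, N (x + y) ≤ N x + N y)
    (hmul : ∀ x y, N (x * y) ≤ N x * N y) (hq : ∀ q x, N (algebraMap ℚ R q * x) ≤ |(q : ℝ)| * N x)
    {ι : Type*} (s : Finset ι) (x : ι → R) {r : ℝ} (hr : 0 ≤ r) (k : ℕ) :
    N (coeff k (∏ i ∈ s, (1 + C (x i) * X))) * r ^ k ≤
      Real.exp (r ^ 2 * (N (∑ i ∈ s, x i) ^ 2 / 4 + c₁ * ∑ i ∈ s, N (x i) ^ 2)) := by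
  set a := ∑ i ∈ s, x i
  set Q := ∏ i ∈ s, ((1 + C (x i) * X) * rescale (-x i) (exp R)) with hQ
  -- Pulling out `e^{aX}` isolates the first-order contribution, so that `N a` enters instead of the
  -- larger `∑ N (x i)`.
  have hfac : ∏ i ∈ s, (1 + C (x i) * X) = rescale a (exp R) * Q := by
    rw [hQ, ← prod_rescale_exp, ← Finset.prod_mul_distrib]
    refine Finset.prod_congr rfl fun i _ => ?_
    linear_combination (-(1 + C (x i) * X)) * rescale_exp_mul_rescale_neg_exp (x i)
  have hQle : WeightedLE N r Q (Real.exp (r ^ 2 * (c₁ * ∑ i ∈ s, N (x i) ^ 2))) := by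
    have h := WeightedLE.prod h0 hz h1 hadd hmul hr s (fun i _ =>
      weightedLE_one_add_mul_rescale_exp h0 h1 hmul hq hr (x i))
    rw [← Real.exp_sum] at h
    convert h using 2
    rw [Finset.mul_sum, Finset.mul_sum]
    exact Finset.sum_congr rfl fun i _ => by ring
  have ht : 0 ≤ N a * r := mul_nonneg (h0 a) hr
  rw [hfac, coeff_mul]
  calc _ ≤ (∑ p ∈ Finset.HasAntidiagonal.antidiagonal k, N (coeff p.1 (rescale a (exp R)) * coeff p.2 Q)) * r ^ k :=
        mul_le_mul_of_nonneg_right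
          (Finset.le_sum_of_subadditive N hz.le hadd _ _) (by positivity)
    _ ≤ ∑ p ∈ Finset.HasAntidiagonal.antidiagonal k,
          Real.exp ((N a * r) ^ 2 / 4) * (N (coeff p.2 Q) * r ^ p.2) := by
        rw [Finset.sum_mul]
        refine Finset.sum_le_sum fun p hp => ?_
        rw [← Finset.HasAntidiagonal.mem_antidiagonal.1 hp, pow_add]
        -- A single coefficient of a product needs only the supremum of the weighted coefficients of
        -- one factor. This gives `exp(t²/4)` in place of the full norm `exp t`, quadratic in `r`
        -- like the bound for `Q`.
        have e1 : N (coeff p.1 (rescale a (exp R))) * r ^ p.1 ≤ Real.exp ((N a * r) ^ 2 / 4) := by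
          refine le_trans ?_ (pow_div_factorial_le_exp ht p.1)
          rw [coeff_rescale, coeff_exp, mul_comm (a ^ p.1), mul_pow, mul_div_right_comm]
          refine mul_le_mul_of_nonneg_right
            ((apply_algebraMap_mul_pow_le h0 h1 hmul hq _ _ _).trans (le_of_eq ?_)) (by positivity)
          simp [inv_mul_eq_div]
        calc N (coeff p.1 (rescale a (exp R)) * coeff p.2 Q) * (r ^ p.1 * r ^ p.2)
            ≤ (N (coeff p.1 (rescale a (exp R))) * N (coeff p.2 Q)) * (r ^ p.1 * r ^ p.2) :=
              mul_le_mul_of_nonneg_right (hmul _ _) (by positivity)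
          _ = (N (coeff p.1 (rescale a (exp R))) * r ^ p.1) * (N (coeff p.2 Q) * r ^ p.2) := by ring
          _ ≤ _ := mul_le_mul_of_nonneg_right e1 (mul_nonneg (h0 _) (by positivity))
    _ = Real.exp ((N a * r) ^ 2 / 4) * ∑ m ∈ Finset.range (k + 1), N (coeff m Q) * r ^ m := by
        rw [← Finset.mul_sum, ← Finset.Nat.sum_antidiagonal_eq_sum_range_succ
          (fun m _ => N (coeff m Q) * r ^ m), ← Finset.Nat.sum_antidiagonal_swap]
        rfl
    _ ≤ Real.exp ((N a * r) ^ 2 / 4) * Real.exp (r ^ 2 * (c₁ * ∑ i ∈ s, N (x i) ^ 2)) :=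
        mul_le_mul_of_nonneg_left (hQle _) (Real.exp_pos _).le
    _ = _ := by rw [← Real.exp_add]; ring_nf

/-- Kerstan's bound for elementary symmetric polynomials. -/
theorem apply_esymm_le (h0 : ∀ x, 0 ≤ N x) (hz : N 0 = 0) (h1 : N 1 ≤ 1)
    (hadd : ∀ x y, N (x + y) ≤ N x + N y)
    (hmul : ∀ x y, N (x * y) ≤ N x * N y) (hq : ∀ q x, N (algebraMap ℚ R q * x) ≤ |(q : ℝ)| * N x)
    {ι : Type*} (s : Finset ι) (x : ι → R) {k : ℕ} (hk : 1 ≤ k) :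
    N (∑ J ∈ s.powersetCard k, ∏ j ∈ J, x j) ≤
      (2 * Real.exp 1 * c₁ * (1 / k * (N (∑ i ∈ s, x i) ^ 2 / (4 * c₁) + ∑ i ∈ s, N (x i) ^ 2))) ^
        ((k : ℝ) / 2) := by
  have hc := c₁_pos
  set S := N (∑ i ∈ s, x i) ^ 2 / (4 * c₁) + ∑ i ∈ s, N (x i) ^ 2 with hS
  have hS0 : 0 ≤ S := by positivity
  have hk0 : (0 : ℝ) < k := by exact_mod_cast hk
  rw [← coeff_prod_one_add_C_mul_X]
  set e := N (coeff k (∏ i ∈ s, (1 + C (x i) * X))) with he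
  have key : ∀ r : ℝ, 0 ≤ r → e * r ^ k ≤ Real.exp (r ^ 2 * (c₁ * S)) := by
    intro r hr
    convert apply_coeff_prod_mul_pow_le h0 hz h1 hadd hmul hq s x hr k using 3
    rw [hS]; field_simp
  have he0 : 0 ≤ e := h0 _
  rcases hS0.eq_or_lt with h | hS0
  -- With `S = 0` the quantity `e r^k` is at most 1 for every `r`; the choice `r = 2/e + 1`
  -- contradicts this when `e > 0`.
  · have h2 : e ≤ 0 := by
      by_contra! hpos
      have h3 := key (2 / e + 1) (by positivity)
      rw [← h, mul_zero, mul_zero, Real.exp_zero] at h3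
      have h4 : 2 / e + 1 ≤ (2 / e + 1) ^ k := le_self_pow₀ (by
        have : 0 ≤ 2 / e := by positivity
        linarith) (by omega)
      have h5 := mul_le_mul_of_nonneg_left h4 he0
      have h6 : e * (2 / e + 1) = 2 + e := by field_simp
      linarith
    exact h2.trans (Real.rpow_nonneg (by positivity) _)
  -- `y` is the value of `r²` that minimises `exp(r² c₁ S) / r^k`.
  · set y := k / (2 * c₁ * S) with hy
    have hy0 : 0 < y := by positivity
    have h2 := key (√y) (Real.sqrt_nonneg _)
    rw [Real.sq_sqrt hy0.le] at h2
    have h3 : y * (c₁ * S) = k / 2 := by rw [hy]; field_simp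
    have h4 : √y ^ k = y ^ ((k : ℝ) / 2) := by
      rw [Real.sqrt_eq_rpow, ← Real.rpow_natCast, ← Real.rpow_mul hy0.le]; congr 1; ring
    have h5 : 2 * Real.exp 1 * c₁ * (1 / k * S) = Real.exp 1 / y := by rw [hy]; field_simp
    rw [h5, Real.div_rpow (Real.exp_pos _).le hy0.le, ← Real.exp_mul, one_mul, le_div_iff₀
      (Real.rpow_pos_of_pos hy0 _), ← h4, ← h3]
    exact h2

end PowerSeries

/-! ### Summation of the tail. -/

section Tail

/-- The right side is the rising factorial `(j + 1) ⋯ (j + β)`. Polynomial growth in `j` is thus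
turned into the coefficients of a negative binomial series. -/
theorem succ_pow_le_factorial_mul_choose (j β : ℕ) :
    (j + 1) ^ β ≤ β.factorial * (j + β).choose β := by
  rw [← Nat.ascFactorial_eq_factorial_mul_choose]
  exact Nat.pow_succ_le_ascFactorial (j + 1) β

/-- Summation of the bounds for the terms of the expansion. -/
theorem sum_rpow_half_le {n ℓ : ℕ} {α C a b : ℝ} (hC : 0 ≤ C)
    (hb : 0 ≤ b) (hCb : C * b < 1) (s : ℕ → ℝ) (hs : ∀ k, 0 ≤ s k)
    (hsa : ∀ k ∈ Icc (ℓ + 1) n, 1 / (k : ℝ) ^ (1 + α) * s k ≤ a)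
    (hsb : ∀ k ∈ Icc (ℓ + 1) n, 1 / (k : ℝ) * s k ≤ b) (ha : 0 ≤ a) :
    ∑ k ∈ Finset.Ico (ℓ + 1) (n + 1), (C * (1 / k * s k)) ^ ((k : ℝ) / 2) ≤
      ((ℓ : ℝ) + 1) ^ ⌈α * (ℓ + 1) / 2⌉₊ * (Nat.factorial ⌈α * (ℓ + 1) / 2⌉₊ : ℝ) *
          ((C * a) ^ (((ℓ : ℝ) + 1) / 2) / (1 - √(C * b)) ^ (⌈α * (ℓ + 1) / 2⌉₊ + 1)) := by
  set β := ⌈α * (ℓ + 1) / 2⌉₊ with hβ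
  set q := √(C * b) with hq
  have hq0 : 0 ≤ q := Real.sqrt_nonneg _
  have hq1 : q < 1 := by
    rw [hq, Real.sqrt_lt' one_pos]; simpa using hCb
  have hgeom := hasSum_choose_mul_geometric_of_norm_lt_one β
    (r := q) (by rwa [Real.norm_of_nonneg hq0])
  set D := ((ℓ : ℝ) + 1) ^ β * (β.factorial : ℝ) * (C * a) ^ (((ℓ : ℝ) + 1) / 2) with hD
  have hterm : ∀ j ∈ Finset.range (n + 1 - (ℓ + 1)),
      (C * (1 / ((ℓ + 1 + j : ℕ) : ℝ) * s (ℓ + 1 + j))) ^ (((ℓ + 1 + j : ℕ) : ℝ) / 2) ≤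
        D * ((((j + β).choose β : ℕ) : ℝ) * q ^ j) := by
    intro j hj
    rw [Finset.mem_range] at hj
    have hk : ℓ + 1 + j ∈ Icc (ℓ + 1) n := ⟨by omega, by omega⟩
    set k := ℓ + 1 + j with hkdef
    have hk1 : (1 : ℝ) ≤ k := by exact_mod_cast (by omega : 1 ≤ k)
    have hk0 : (0 : ℝ) < k := by linarith
    have hx0 : 0 ≤ C * (1 / k * s k) := mul_nonneg hC (mul_nonneg (by positivity) (hs k))
    have hxb : C * (1 / k * s k) ≤ C * b := mul_le_mul_of_nonneg_left (hsb k hk) hC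
    have hxa : C * (1 / k * s k) ≤ (k : ℝ) ^ α * (C * a) := by
      have h := mul_le_mul_of_nonneg_left (hsa k hk) (by positivity : 0 ≤ C * (k : ℝ) ^ α)
      refine le_trans (le_of_eq ?_) (h.trans (le_of_eq (by ring)))
      rw [Real.rpow_add hk0, Real.rpow_one]
      have : (k : ℝ) ^ α ≠ 0 := (Real.rpow_pos_of_pos hk0 _).ne'
      field_simp
    -- Of the exponent `k / 2`, the part `(ℓ + 1) / 2` is estimated by `a` at the price of a power
    -- of `k`, and the remaining `j / 2` by `b`, which yields the geometric factor `q ^ j`.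
    have h1 : (C * (1 / k * s k)) ^ ((k : ℝ) / 2) =
        (C * (1 / k * s k)) ^ (((ℓ : ℝ) + 1) / 2) * (C * (1 / k * s k)) ^ ((j : ℝ) / 2) := by
      rw [← Real.rpow_add_of_nonneg hx0 (by positivity) (by positivity)]
      congr 1; rw [hkdef]; push_cast; ring
    have h2 : (C * (1 / k * s k)) ^ ((j : ℝ) / 2) ≤ q ^ j := by
      refine (Real.rpow_le_rpow hx0 hxb (by positivity)).trans (le_of_eq ?_)
      rw [hq, Real.sqrt_eq_rpow, ← Real.rpow_natCast, ← Real.rpow_mul (by positivity)]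
      congr 1; ring
    have h3 : (k : ℝ) ^ (α * ((ℓ : ℝ) + 1) / 2) ≤
        ((ℓ : ℝ) + 1) ^ β * ((β.factorial : ℝ) * ((j + β).choose β : ℕ)) := by
      calc (k : ℝ) ^ (α * ((ℓ : ℝ) + 1) / 2) ≤ (k : ℝ) ^ (β : ℝ) :=
            Real.rpow_le_rpow_of_exponent_le hk1 (Nat.le_ceil _)
        _ = (k : ℝ) ^ β := Real.rpow_natCast _ _
        -- `k = ℓ + 1 + j ≤ (ℓ + 1)(j + 1)` separates `ℓ` from the summation index.
        _ ≤ (((ℓ : ℝ) + 1) * (j + 1)) ^ β := by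
            gcongr
            rw [hkdef]; push_cast
            have : (0 : ℝ) ≤ ℓ * j := by positivity
            linarith
        _ = ((ℓ : ℝ) + 1) ^ β * ((j : ℝ) + 1) ^ β := mul_pow _ _ _
        _ ≤ _ := by
            gcongr
            exact_mod_cast succ_pow_le_factorial_mul_choose j β
    have h4 : (C * (1 / k * s k)) ^ (((ℓ : ℝ) + 1) / 2) ≤
        (k : ℝ) ^ (α * ((ℓ : ℝ) + 1) / 2) * (C * a) ^ (((ℓ : ℝ) + 1) / 2) := by
      refine (Real.rpow_le_rpow hx0 hxa (by positivity)).trans (le_of_eq ?_)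
      rw [Real.mul_rpow (by positivity) (by positivity), ← Real.rpow_mul hk0.le]
      congr 2; ring
    rw [h1]
    calc _ ≤ (((ℓ : ℝ) + 1) ^ β * ((β.factorial : ℝ) * ((j + β).choose β : ℕ)) *
            (C * a) ^ (((ℓ : ℝ) + 1) / 2)) * q ^ j :=
          mul_le_mul (h4.trans (mul_le_mul_of_nonneg_right h3 (by positivity))) h2
            (by positivity) (by positivity)
      _ = _ := by rw [hD]; ring
  rw [Finset.sum_Ico_eq_sum_range]
  calc _ ≤ ∑ j ∈ Finset.range (n + 1 - (ℓ + 1)), D * ((((j + β).choose β : ℕ) : ℝ) * q ^ j) :=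
        Finset.sum_le_sum hterm
    _ ≤ D * (1 / (1 - q) ^ (β + 1)) :=
        sum_le_hasSum _ (fun j _ => by positivity) (hgeom.mul_left D)
    _ = _ := by rw [hD]; ring

end Tail

/-! ### The expansion around `G` and part (a). -/

/-- Every product has exactly `k` factors, so `g ^ m` can be shared equally among them, up to the
remainder of `m` modulo `k`. -/
theorem esymm_mul_pow {R ι : Type*} [CommRing R] (s : Finset ι) (x : ι → R) (g : R) (m k : ℕ) :
    (∑ J ∈ s.powersetCard k, ∏ j ∈ J, x j) * g ^ m =
      (∑ J ∈ s.powersetCard k, ∏ j ∈ J, x j * g ^ (m / k)) * g ^ (m - m / k * k) := by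
  conv_lhs => rw [← Nat.sub_add_cancel (Nat.div_mul_le_self m k), pow_add,
    mul_comm (_ ^ _) (_ ^ _), ← mul_assoc]
  congr 1
  rw [Finset.sum_mul]
  refine Finset.sum_congr rfl fun J hJ => ?_
  rw [Finset.mem_powersetCard] at hJ
  rw [Finset.prod_mul_distrib, Finset.prod_const, hJ.2, pow_mul]

section Expansion

variable {𝔛 : Type*} [AddCommGroup 𝔛] [MeasurableSpace 𝔛] [MeasurableSub₂ 𝔛]

theorem tvNorm_algebraMap_mul_le (q : ℚ) (x : SignedMeasure 𝔛) :
    tvNorm (algebraMap ℚ (SignedMeasure 𝔛) q * x) ≤ |(q : ℝ)| * tvNorm x := by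
  rw [← Algebra.smul_def]
  exact (tvNorm_rat_smul q x).le

theorem tvNorm_esymm_le {ι : Type*} (s : Finset ι) (x : ι → SignedMeasure 𝔛) {k : ℕ}
    (hk : 1 ≤ k) :
    tvNorm (∑ J ∈ s.powersetCard k, ∏ j ∈ J, x j) ≤
      (2 * Real.exp 1 * c₁ * (1 / k * (tvNorm (∑ i ∈ s, x i) ^ 2 / (4 * c₁) +
        ∑ i ∈ s, tvNorm (x i) ^ 2))) ^ ((k : ℝ) / 2) := by
  have h := apply_esymm_le (N := tvNorm (𝔛 := 𝔛)) tvNorm_nonneg tvNorm_zero tvNorm_one_le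
    tvNorm_add_le tvNorm_mul_le tvNorm_algebraMap_mul_le s x hk
  convert h using 1

variable {n : ℕ}
  (F : Fin n → Measure 𝔛) (G : Measure 𝔛) [∀ j, IsFiniteMeasure (F j)]

theorem prod_toSignedMeasure_eq [IsFiniteMeasure G] : ∏ j, (F j).toSignedMeasure =
    ∑ k ∈ Finset.range (n + 1), V F G k * G.toSignedMeasure ^ (n - k) := by
  have h : ∏ j, (F j).toSignedMeasure =
      ∏ j, (((F j).toSignedMeasure - G.toSignedMeasure) + G.toSignedMeasure) := by
    simp
  rw [h, Finset.prod_add, Finset.sum_powerset, Finset.card_univ, Fintype.card_fin]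
  refine Finset.sum_congr rfl fun k _ => ?_
  rw [V, Finset.sum_mul]
  refine Finset.sum_congr rfl fun J hJ => ?_
  rw [Finset.mem_powersetCard] at hJ
  rw [Finset.prod_const, ← Finset.compl_eq_univ_sdiff, Finset.card_compl, Fintype.card_fin, hJ.2]

theorem prod_sub_W_eq [IsFiniteMeasure G] {ℓ : ℕ} (hℓ : ℓ ≤ n) :
    (∏ j, (F j).toSignedMeasure) - W F G ℓ =
      ∑ k ∈ Finset.Ico (ℓ + 1) (n + 1), V F G k * G.toSignedMeasure ^ (n - k) := by
  rw [prod_toSignedMeasure_eq F G, W, sub_eq_iff_eq_add', Finset.sum_range_add_sum_Ico _ (by omega)]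

theorem tvNorm_V_mul_le [IsProbabilityMeasure G] {k : ℕ} (hk : 1 ≤ k) :
    tvNorm (V F G k * G.toSignedMeasure ^ (n - k)) ≤
      (2 * Real.exp 1 * c₁ * (1 / k * (nuTilde F G k ^ 2 / (4 * c₁) + nu F G k 2))) ^
        ((k : ℝ) / 2) := by
  have hG := tvNorm_toSignedMeasure_le_one G
  have h : V F G k * G.toSignedMeasure ^ (n - k) =
      (∑ J ∈ (Finset.univ : Finset (Fin n)).powersetCard k, ∏ j ∈ J, M F G j k) *
        G.toSignedMeasure ^ (n - k - (n - k) / k * k) :=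
    esymm_mul_pow _ _ _ _ _
  rw [h]
  refine (tvNorm_mul_le _ _).trans
    ((mul_le_of_le_one_right (tvNorm_nonneg _) (tvNorm_pow_le_one hG _)).trans ?_)
  exact tvNorm_esymm_le Finset.univ (fun j => M F G j k) hk

theorem nuTilde_sq_add_nu_nonneg [IsFiniteMeasure G] (k : ℕ) :
    0 ≤ nuTilde F G k ^ 2 / (4 * c₁) + nu F G k 2 := by
  have := c₁_pos
  unfold nu
  positivity

theorem eta_nonneg [IsFiniteMeasure G] (ℓ : ℕ) (α : ℝ) : 0 ≤ eta F G ℓ α := by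
  refine Real.sSup_nonneg ?_
  rintro _ ⟨k, _, rfl⟩
  exact mul_nonneg (by positivity) (nuTilde_sq_add_nu_nonneg F G k)

theorem le_eta [IsFiniteMeasure G] {ℓ k : ℕ} (hk : k ∈ Icc (ℓ + 1) n) (α : ℝ) :
    1 / (k : ℝ) ^ (1 + α) * (nuTilde F G k ^ 2 / (4 * c₁) + nu F G k 2) ≤ eta F G ℓ α :=
  le_csSup ((finite_Icc _ _).image _).bddAbove (mem_image_of_mem _ hk)

theorem tvNorm_prod_sub_W_le [IsProbabilityMeasure G] (α : ℝ) {ℓ : ℕ} (hℓ : ℓ ≤ n)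
    (h : eta F G ℓ 0 < (2 * Real.exp 1 * c₁)⁻¹) :
    tvNorm ((∏ j, (F j).toSignedMeasure) - W F G ℓ) ≤
      ((ℓ : ℝ) + 1) ^ ⌈α * (ℓ + 1) / 2⌉₊ * (Nat.factorial ⌈α * (ℓ + 1) / 2⌉₊ : ℝ) *
        ((2 * Real.exp 1 * c₁ * eta F G ℓ α) ^ (((ℓ : ℝ) + 1) / 2) /
          (1 - √(2 * Real.exp 1 * c₁ * eta F G ℓ 0)) ^ (⌈α * (ℓ + 1) / 2⌉₊ + 1)) := by
  have hc : 0 < 2 * Real.exp 1 * c₁ := by have := c₁_pos; positivity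
  rw [prod_sub_W_eq F G hℓ]
  refine (tvNorm_sum_le _ _).trans ((Finset.sum_le_sum fun k hk => tvNorm_V_mul_le F G
    (by rw [Finset.mem_Ico] at hk; omega)).trans ?_)
  refine sum_rpow_half_le hc.le (eta_nonneg F G ℓ 0) ?_
    (fun k => nuTilde F G k ^ 2 / (4 * c₁) + nu F G k 2) (nuTilde_sq_add_nu_nonneg F G)
    (fun k hk => le_eta F G hk α) (fun k hk => ?_) (eta_nonneg F G ℓ α)
  · rwa [inv_eq_one_div, lt_div_iff₀' hc] at h
  · simpa using le_eta F G hk 0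

end Expansion

/-! ### Smoothing by convolution powers of `G`. -/

section Symmetrization

variable {𝔛 : Type*} [AddCommGroup 𝔛] [MeasurableSpace 𝔛] [MeasurableSub₂ 𝔛]

theorem measurable_sum_pi (m : ℕ) : Measurable fun x : Fin m → 𝔛 => ∑ i, x i := by
  have : MeasurableAdd₂ 𝔛 := measurableAdd₂_of_sub
  fun_prop

/-- Convolving `g dG` with the law of a sum of `m` independent variables with law `G`: the density
may be put on any of the `m + 1` coordinates. -/
theorem conv_map_sum_pi_apply (G : Measure 𝔛) [IsProbabilityMeasure G] {m : ℕ} (i : Fin (m + 1))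
    {g : 𝔛 → ℝ≥0∞} (hg : Measurable g) {A : Set 𝔛} (hA : MeasurableSet A) :
    ((G.withDensity g).conv ((Measure.pi fun _ : Fin m => G).map fun x => ∑ i, x i)) A =
      ∫⁻ x in (fun x : Fin (m + 1) → 𝔛 => ∑ i, x i) ⁻¹' A, g (x i)
        ∂(Measure.pi fun _ : Fin (m + 1) => G) := by
  have : MeasurableAdd₂ 𝔛 := measurableAdd₂_of_sub
  have hs := measurable_sum_pi (𝔛 := 𝔛)
  have hi : Measurable (A.indicator (1 : 𝔛 → ℝ≥0∞)) := measurable_one.indicator hA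
  have hprod : Measurable fun p : 𝔛 × (Fin m → 𝔛) =>
      g p.1 * A.indicator 1 (p.1 + ∑ i, p.2 i) :=
    (hg.comp measurable_fst).mul
      (hi.comp (measurable_fst.add ((hs m).comp measurable_snd)))
  have hmp := measurePreserving_piFinSuccAbove (fun _ : Fin (m + 1) => G) i
  rw [← lintegral_indicator_one hA, Measure.lintegral_conv hi,
    lintegral_withDensity_eq_lintegral_mul _ hg (by fun_prop),
    ← lintegral_indicator ((hs _) hA)]
  calc _ = ∫⁻ x, ∫⁻ z, g x * A.indicator 1 (x + ∑ i, z i) ∂(Measure.pi fun _ : Fin m => G) ∂G := by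
        refine lintegral_congr fun x => ?_
        rw [Pi.mul_apply, lintegral_map (by fun_prop) (hs m), lintegral_const_mul]
        exact hi.comp (measurable_const.add (hs m))
    _ = ∫⁻ p, g p.1 * A.indicator 1 (p.1 + ∑ i, p.2 i)
          ∂(G.prod (Measure.pi fun _ : Fin m => G)) := (lintegral_prod _ hprod.aemeasurable).symm
    _ = _ := by
        rw [← hmp.lintegral_comp hprod]
        refine lintegral_congr fun x => ?_
        have e : (∑ j, x j) = x i + ∑ j, x (i.succAbove j) := Fin.sum_univ_succAbove _ i
        simp only [MeasurableEquiv.piFinSuccAbove_apply, Fin.insertNthEquiv_symm_apply,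
          Fin.removeNth]
        rw [← e]
        by_cases hx : ∑ j, x j ∈ A
        · have hx' : x ∈ (fun x : Fin (m + 1) → 𝔛 => ∑ j, x j) ⁻¹' A := hx
          rw [indicator_of_mem hx, indicator_of_mem hx', Pi.one_apply, mul_one]
        · have hx' : x ∉ (fun x : Fin (m + 1) → 𝔛 => ∑ j, x j) ⁻¹' A := hx
          rw [indicator_of_notMem hx, indicator_of_notMem hx', mul_zero]

theorem toSignedMeasure_map_sum_pi (G : Measure 𝔛) [IsProbabilityMeasure G] (m : ℕ) :
    ((Measure.pi fun _ : Fin m => G).map fun x => ∑ i, x i).toSignedMeasure =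
      G.toSignedMeasure ^ m := by
  have : MeasurableAdd₂ 𝔛 := measurableAdd₂_of_sub
  induction m with
  | zero =>
    rw [pow_zero, one_def]
    refine Measure.toSignedMeasure_congr ?_
    simp only [Finset.univ_eq_empty, Finset.sum_empty, Measure.map_const, measure_univ, one_smul]
  | succ m ih =>
    rw [pow_succ', ← ih, mul_toSignedMeasure]
    refine Measure.toSignedMeasure_congr ?_
    ext A hA
    have h := conv_map_sum_pi_apply G (0 : Fin (m + 1)) measurable_one hA
    rw [withDensity_one] at h
    rw [h, Measure.map_apply (measurable_sum_pi _) hA]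
    simp

/-- The left side does not involve `i`; this freedom is what permits averaging over all coordinates.
-/
theorem withDensityᵥ_mul_pow_apply (G : Measure 𝔛) [IsProbabilityMeasure G] {m : ℕ}
    (i : Fin (m + 1)) {h : 𝔛 → ℝ} (hm : Measurable h) (hi : Integrable h G) {A : Set 𝔛}
    (hA : MeasurableSet A) :
    (G.withDensityᵥ h * G.toSignedMeasure ^ m) A =
      ∫ x in (fun x : Fin (m + 1) → 𝔛 => ∑ i, x i) ⁻¹' A, h (x i)
        ∂(Measure.pi fun _ : Fin (m + 1) => G) := by
  have : IsFiniteMeasure (G.withDensity fun x => ENNReal.ofReal (h x)) :=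
    isFiniteMeasure_withDensity_ofReal hi.2
  have : IsFiniteMeasure (G.withDensity fun x => ENNReal.ofReal (-h x)) :=
    isFiniteMeasure_withDensity_ofReal hi.neg.2
  have hint : Integrable (fun x : Fin (m + 1) → 𝔛 => h (x i))
      (Measure.pi fun _ : Fin (m + 1) => G) :=
    (measurePreserving_eval (fun _ : Fin (m + 1) => G) i).integrable_comp_of_integrable hi
  rw [withDensityᵥ_eq_withDensity_pos_part_sub_withDensity_neg_part hi, sub_mul,
    ← toSignedMeasure_map_sum_pi, mul_toSignedMeasure, mul_toSignedMeasure,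
    Measure.toSignedMeasure_sub_apply hA, measureReal_def, measureReal_def,
    conv_map_sum_pi_apply G i hm.ennreal_ofReal hA,
    conv_map_sum_pi_apply G i (g := fun x => ENNReal.ofReal (-h x)) hm.neg.ennreal_ofReal hA,
    integral_eq_lintegral_pos_part_sub_lintegral_neg_part hint.integrableOn]

theorem sq_integral_abs_le {Ω : Type*} [MeasurableSpace Ω] (P : Measure Ω) [IsProbabilityMeasure P]
    {H : Ω → ℝ} (hH : MemLp H 2 P) : (∫ x, |H x| ∂P) ^ 2 ≤ ∫ x, H x ^ 2 ∂P := by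
  have h := ProbabilityTheory.variance_nonneg (fun x => |H x|) P
  have h' : MemLp (fun x => |H x|) 2 P := hH.norm
  rw [ProbabilityTheory.variance_eq_sub h'] at h
  simpa using h

/-- Smoothing: convolution with `Gᵐ` shrinks centred square integrable densities. -/
theorem tvNorm_withDensityᵥ_mul_pow_le (G : Measure 𝔛) [IsProbabilityMeasure G] (m : ℕ)
    {h : 𝔛 → ℝ} (hm : Measurable h) (h2 : MemLp h 2 G) (h0 : ∫ x, h x ∂G = 0) :
    tvNorm (G.withDensityᵥ h * G.toSignedMeasure ^ m) ≤
      √(1 / (m + 1)) * √(∫ x, h x ^ 2 ∂G) := by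
  set P := Measure.pi fun _ : Fin (m + 1) => G
  set U := G.withDensityᵥ h * G.toSignedMeasure ^ m with hU
  set H : (Fin (m + 1) → 𝔛) → ℝ := ∑ i, fun x => h (x i) with hH
  have hi : Integrable h G := h2.integrable one_le_two
  have hint (i : Fin (m + 1)) : Integrable (fun x : Fin (m + 1) → 𝔛 => h (x i)) P :=
    (measurePreserving_eval (fun _ : Fin (m + 1) => G) i).integrable_comp_of_integrable hi
  have hmem (i : Fin (m + 1)) : MemLp (fun x : Fin (m + 1) → 𝔛 => h (x i)) 2 P :=
    h2.comp_measurePreserving (measurePreserving_eval (fun _ : Fin (m + 1) => G) i)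
  have hHmem : MemLp H 2 P := memLp_finsetSum' _ fun i _ => hmem i
  have hHint : Integrable H P := hHmem.integrable one_le_two
  -- Adding the `m + 1` representations of `U A` replaces `h (x i)` by the sum `H` of independent
  -- centred variables.
  have hUA {A : Set 𝔛} (hA : MeasurableSet A) :
      ((m : ℝ) + 1) * U A = ∫ x in (fun x : Fin (m + 1) → 𝔛 => ∑ i, x i) ⁻¹' A, H x ∂P := by
    simp only [hH, Finset.sum_apply]
    rw [integral_finsetSum _ fun i _ => (hint i).integrableOn]
    rw [Finset.sum_congr rfl fun i _ => (withDensityᵥ_mul_pow_apply G i hm hi hA).symm]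
    simp [hU]
  have hint0 : ∫ x, H x ∂P = 0 := by
    simp only [hH, Finset.sum_apply]
    rw [integral_finsetSum _ fun i _ => hint i]
    refine Finset.sum_eq_zero fun i _ => ?_
    rw [← h0, ← (measurePreserving_eval (fun _ : Fin (m + 1) => G) i).map_eq,
      integral_map (measurable_pi_apply i).aemeasurable hm.aestronglyMeasurable]
  -- By independence the variance grows like `m + 1`, whereas `U` was multiplied by `m + 1`; this is
  -- the source of the gain `1/√(m+1)`.
  have hvar : ∫ x, H x ^ 2 ∂P = (m + 1) * ∫ x, h x ^ 2 ∂G := by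
    have e := ProbabilityTheory.variance_sum_pi (μ := fun _ : Fin (m + 1) => G)
      (X := fun _ => h) (fun _ => h2)
    rw [ProbabilityTheory.variance_of_integral_eq_zero hHint.aemeasurable hint0] at e
    rw [e]
    simp [ProbabilityTheory.variance_of_integral_eq_zero hm.aemeasurable h0]
  obtain ⟨A, hA, htv⟩ := exists_tvNorm_eq U
  have hSA := measurable_sum_pi (m + 1) hA
  have h1 : ((m : ℝ) + 1) * tvNorm U ≤ ∫ x, |H x| ∂P := by
    rw [htv, mul_sub, hUA hA, hUA hA.compl, preimage_compl,
      ← integral_add_compl hSA hHint.abs, sub_eq_add_neg, ← integral_neg]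
    exact add_le_add
      (integral_mono hHint.integrableOn hHint.abs.integrableOn fun x => le_abs_self _)
      (integral_mono hHint.neg.integrableOn hHint.abs.integrableOn fun x => neg_le_abs _)
  have h3 : (((m : ℝ) + 1) * tvNorm U) ^ 2 ≤ (m + 1) * ∫ x, h x ^ 2 ∂G :=
    (pow_le_pow_left₀ (mul_nonneg (by positivity) (tvNorm_nonneg _)) h1 2).trans
      ((sq_integral_abs_le P hHmem).trans hvar.le)
  rw [← Real.sqrt_mul (by positivity)]
  refine Real.le_sqrt_of_sq_le ?_
  have hm0 : (0 : ℝ) < (m : ℝ) + 1 := by positivity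
  rw [one_div, inv_mul_eq_div, le_div_iff₀ hm0]
  refine le_of_mul_le_mul_left ?_ hm0
  calc _ = (((m : ℝ) + 1) * tvNorm U) ^ 2 := by ring
    _ ≤ _ := h3

end Symmetrization

/-! ### Densities and the mean measure. -/

section Density

variable {𝔛 : Type*} [MeasurableSpace 𝔛]

/-- When `l2Term` is finite, it is the `L²`-norm of the density `1_{Bᶜ} (f - 1)`. -/
theorem memLp_and_l2Term_eq {G : Measure 𝔛} [IsFiniteMeasure G] {f : 𝔛 → ℝ} (hf : Measurable f)
    {B : Set 𝔛} (hB : MeasurableSet B) (h : l2Term G f B ≠ ⊤) :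
    MemLp (Bᶜ.indicator fun x => f x - 1) 2 G ∧
      l2Term G f B =
        ENNReal.ofReal √(∫ x, (Bᶜ.indicator (fun x => f x - 1) x) ^ 2 ∂G) := by
  have hm : Measurable (Bᶜ.indicator fun x => f x - 1) := (hf.sub_const 1).indicator hB.compl
  have e : ∫⁻ x in Bᶜ, ENNReal.ofReal ((f x - 1) ^ 2) ∂G =
      ∫⁻ x, ENNReal.ofReal ((Bᶜ.indicator (fun x => f x - 1) x) ^ 2) ∂G := by
    rw [← lintegral_indicator hB.compl]
    refine lintegral_congr fun x => ?_
    by_cases hx : x ∈ Bᶜ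
    · simp only [indicator_of_mem hx]
    · simp [indicator_of_notMem hx]
  have hfin : ∫⁻ x, ENNReal.ofReal ((Bᶜ.indicator (fun x => f x - 1) x) ^ 2) ∂G ≠ ⊤ := by
    rw [← e]
    intro h'
    apply h
    rw [l2Term, h', ENNReal.top_rpow_of_pos (by norm_num)]
  have hint : Integrable (fun x => (Bᶜ.indicator (fun x => f x - 1) x) ^ 2) G := by
    refine ⟨(hm.pow_const 2).aestronglyMeasurable, ?_⟩
    rw [hasFiniteIntegral_iff_ofReal (Filter.Eventually.of_forall fun x => sq_nonneg _)]
    exact hfin.lt_top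
  refine ⟨(memLp_two_iff_integrable_sq hm.aestronglyMeasurable).2 hint, ?_⟩
  rw [l2Term, e, ← ofReal_integral_eq_lintegral_ofReal hint
    (Filter.Eventually.of_forall fun x => sq_nonneg _),
    ENNReal.ofReal_rpow_of_nonneg (integral_nonneg fun x => sq_nonneg _) (by norm_num),
    Real.sqrt_eq_rpow]

theorem sub_eq_restrict_add_withDensityᵥ {F G : Measure 𝔛} [IsFiniteMeasure F]
    [IsFiniteMeasure G] {f : 𝔛 → ℝ} {B : Set 𝔛} (hB : MeasurableSet B)
    (hf : IsDensity (F.restrict Bᶜ) G f)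
    (hi : Integrable (Bᶜ.indicator fun x => f x - 1) G) :
    F.toSignedMeasure - G.toSignedMeasure =
      (F.toSignedMeasure - G.toSignedMeasure).restrict B +
        G.withDensityᵥ (Bᶜ.indicator fun x => f x - 1) := by
  obtain ⟨hfm, hf0, hfd⟩ := hf
  ext A hA
  have hfi : IntegrableOn f Bᶜ G := by
    have h1 : IntegrableOn (fun x => f x - 1) Bᶜ G := (integrable_indicator_iff hB.compl).1 hi
    have h2 := h1.add (integrable_const (1 : ℝ))
    exact h2.congr (Filter.Eventually.of_forall fun x => by simp)
  have hF : F.real (A ∩ Bᶜ) = ∫ x in A ∩ Bᶜ, f x ∂G := by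
    rw [integral_eq_lintegral_of_nonneg_ae (ae_restrict_of_ae hf0)
      hfm.aestronglyMeasurable, ← withDensity_apply _ (hA.inter hB.compl), ← hfd,
      Measure.restrict_apply (hA.inter hB.compl), inter_assoc, inter_self, measureReal_def]
  rw [_root_.add_apply, VectorMeasure.restrict_apply _ hB hA,
    withDensityᵥ_apply hi hA, setIntegral_indicator hB.compl,
    integral_sub (hfi.mono_set inter_subset_right) (integrable_const _), ← hF,
    Measure.toSignedMeasure_sub_apply hA, Measure.toSignedMeasure_sub_apply (hA.inter hB),
    ← measureReal_inter_add_sdiff (μ := F) (s := A) hB,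
    ← measureReal_inter_add_sdiff (μ := G) (s := A) hB, sdiff_eq]
  simp
  ring

theorem withDensityᵥ_const (G : Measure 𝔛) [IsFiniteMeasure G] (c : ℝ) :
    G.withDensityᵥ (fun _ => c) = c • G.toSignedMeasure := by
  ext A hA
  rw [withDensityᵥ_apply (integrable_const c) hA, _root_.smul_apply,
    Measure.toSignedMeasure_apply_measurable hA]
  simp [mul_comm]

theorem meanMeasure_real_apply {n : ℕ} (F : Fin n → Measure 𝔛) [∀ j, IsFiniteMeasure (F j)]
    (A : Set 𝔛) : (meanMeasure F).real A = (n : ℝ)⁻¹ * ∑ j, (F j).real A := by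
  rw [meanMeasure, measureReal_nnreal_smul_apply, measureReal_def, Measure.finsetSum_apply,
    ENNReal.toReal_sum fun j _ => measure_ne_top _ _]
  simp [measureReal_def]

theorem isProbabilityMeasure_meanMeasure {n : ℕ} (hn : n ≠ 0) (F : Fin n → Measure 𝔛)
    [∀ j, IsProbabilityMeasure (F j)] : IsProbabilityMeasure (meanMeasure F) := by
  rw [isProbabilityMeasure_iff_real, meanMeasure_real_apply]
  simp [hn]

/-- Through this identity `ν̃_k` is `n` times a norm of the same form as `‖M_{j,k}‖`, with the mean
in place of `F j`, so one estimate serves both. -/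
theorem sum_sub_eq_smul_meanMeasure_sub {n : ℕ} (hn : n ≠ 0) (F : Fin n → Measure 𝔛)
    (G : Measure 𝔛) [∀ j, IsFiniteMeasure (F j)] [IsFiniteMeasure G] :
    ∑ j, ((F j).toSignedMeasure - G.toSignedMeasure) =
      n • ((meanMeasure F).toSignedMeasure - G.toSignedMeasure) := by
  ext A hA
  have e : ∀ s : Finset (Fin n), (∑ j ∈ s, ((F j).toSignedMeasure - G.toSignedMeasure)) A =
      ∑ j ∈ s, ((F j).real A - G.real A) := by
    intro s
    induction s using Finset.induction_on with
    | empty => simp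
    | insert a s ha ih =>
      rw [Finset.sum_insert ha, Finset.sum_insert ha, _root_.add_apply, ih,
        Measure.toSignedMeasure_sub_apply hA]
  rw [e, _root_.smul_apply, Measure.toSignedMeasure_sub_apply hA, meanMeasure_real_apply,
    Finset.sum_sub_distrib, nsmul_eq_mul]
  simp only [Finset.sum_const, Finset.card_univ, Fintype.card_fin, nsmul_eq_mul]
  field_simp

end Density

/-! ### Part (b). -/

section Bound

variable {𝔛 : Type*} [AddCommGroup 𝔛] [MeasurableSpace 𝔛] [MeasurableSub₂ 𝔛]

theorem ofReal_tvNorm_sub_mul_pow_le (F G : Measure 𝔛) [IsProbabilityMeasure F]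
    [IsProbabilityMeasure G] {f : 𝔛 → ℝ} {B : Set 𝔛} (hB : MeasurableSet B)
    (hf : IsDensity (F.restrict Bᶜ) G f) (m : ℕ) :
    ENNReal.ofReal (tvNorm ((F.toSignedMeasure - G.toSignedMeasure) * G.toSignedMeasure ^ m)) ≤
      ENNReal.ofReal (restrTerm (F.toSignedMeasure - G.toSignedMeasure) B) +
        ENNReal.ofReal √(1 / (m + 1)) * l2Term G f B := by
  rcases eq_or_ne (l2Term G f B) ⊤ with htop | htop
  -- The factor `√(1/(m+1))` is positive, so an infinite `l2Term` makes the right side infinite.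
  · rw [htop, ENNReal.mul_top, add_top]
    · exact le_top
    · rw [Ne, ENNReal.ofReal_eq_zero, not_le]
      positivity
  obtain ⟨h2, hl⟩ := memLp_and_l2Term_eq hf.1 hB htop
  set h := Bᶜ.indicator fun x => f x - 1 with hh
  have hm : Measurable h := (hf.1.sub_const 1).indicator hB.compl
  have hi : Integrable h G := h2.integrable one_le_two
  set c := ∫ x, h x ∂G with hc
  set U := F.toSignedMeasure - G.toSignedMeasure with hU
  have hdec := sub_eq_restrict_add_withDensityᵥ hB hf hi
  rw [← hU, ← hh] at hdec
  have hUuniv : U univ = 0 := by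
    rw [hU, Measure.toSignedMeasure_sub_apply MeasurableSet.univ]; simp
  -- `F` and `G` have equal mass, so the mean of the density part must cancel `U B`; this is where
  -- `|V B|` in `restrTerm` comes from.
  have hcB : c = -U B := by
    have h1 := congrArg (fun V : SignedMeasure 𝔛 => V univ) hdec
    simp only [_root_.add_apply] at h1
    rw [hUuniv, VectorMeasure.restrict_apply _ hB MeasurableSet.univ, univ_inter,
      withDensityᵥ_apply hi MeasurableSet.univ, setIntegral_univ] at h1
    linarith
  -- Smoothing needs a centred density. Centring costs `|c|` in norm and does not increase the
  -- `L²`-norm (`hvar`).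
  have hsplit : G.withDensityᵥ h = G.withDensityᵥ (fun x => h x - c) + c • G.toSignedMeasure := by
    have e : Integrable (fun x => h x - c) G := hi.sub (integrable_const c)
    rw [← withDensityᵥ_const, ← withDensityᵥ_add' e (integrable_const c)]
    simp
  have h0 : ∫ x, (h x - c) ∂G = 0 := by
    rw [integral_sub hi (integrable_const c)]; simp [hc]
  have hG := tvNorm_toSignedMeasure_le_one G
  have hGm := tvNorm_pow_le_one hG m
  have hsm := tvNorm_withDensityᵥ_mul_pow_le G m (hm.sub_const c) (h2.sub (memLp_const c)) h0
  have hvar : ∫ x, (h x - c) ^ 2 ∂G ≤ ∫ x, h x ^ 2 ∂G := by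
    have e := ProbabilityTheory.variance_le_expectation_sq hm.aestronglyMeasurable (μ := G)
    rw [ProbabilityTheory.variance_eq_integral hm.aemeasurable] at e
    simpa using e
  have key : tvNorm (U * G.toSignedMeasure ^ m) ≤
      restrTerm U B + √(1 / (m + 1)) * √(∫ x, h x ^ 2 ∂G) := by
    have e : U * G.toSignedMeasure ^ m = U.restrict B * G.toSignedMeasure ^ m +
        (G.withDensityᵥ (fun x => h x - c) * G.toSignedMeasure ^ m +
          (c • G.toSignedMeasure) * G.toSignedMeasure ^ m) := by
      conv_lhs => rw [hdec, hsplit]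
      ring
    rw [e]
    have e1 := tvNorm_add_le (U.restrict B * G.toSignedMeasure ^ m)
        (G.withDensityᵥ (fun x => h x - c) * G.toSignedMeasure ^ m +
          (c • G.toSignedMeasure) * G.toSignedMeasure ^ m)
    have e2 := tvNorm_add_le (G.withDensityᵥ (fun x => h x - c) * G.toSignedMeasure ^ m)
          ((c • G.toSignedMeasure) * G.toSignedMeasure ^ m)
    have e3 : tvNorm (U.restrict B * G.toSignedMeasure ^ m) ≤ tvNorm (U.restrict B) :=
      (tvNorm_mul_le _ _).trans (mul_le_of_le_one_right (tvNorm_nonneg _) hGm)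
    have e4 : tvNorm ((c • G.toSignedMeasure) * G.toSignedMeasure ^ m) ≤ |U B| := by
      refine (tvNorm_mul_le _ _).trans ((mul_le_of_le_one_right (tvNorm_nonneg _) hGm).trans ?_)
      rw [tvNorm_smul, hcB, abs_neg]
      exact mul_le_of_le_one_right (abs_nonneg _) hG
    have e5 : √(1 / ((m : ℝ) + 1)) * √(∫ x, (h x - c) ^ 2 ∂G) ≤
        √(1 / (m + 1)) * √(∫ x, h x ^ 2 ∂G) :=
      mul_le_mul_of_nonneg_left (Real.sqrt_le_sqrt hvar) (Real.sqrt_nonneg _)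
    rw [restrTerm]
    linarith
  have hr : 0 ≤ restrTerm U B := add_nonneg (tvNorm_nonneg _) (abs_nonneg _)
  rw [hl, ← ENNReal.ofReal_mul (Real.sqrt_nonneg _), ← ENNReal.ofReal_add hr (by positivity)]
  exact ENNReal.ofReal_le_ofReal key

/-- With `q = ⌊(n-k)/k⌋`, division with remainder gives `n < k (q + 2)`, and `q + 2 ≤ 2 (q + 1)`. -/
theorem one_div_floor_le {n k : ℕ} (hk : 1 ≤ k) (hkn : k ≤ n) :
    1 / ((((n - k) / k : ℕ) : ℝ) + 1) ≤ 2 / n * k := by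
  have h1 : n < 2 * k * ((n - k) / k + 1) := by
    have h := Nat.lt_div_mul_add (a := n - k) (b := k) (by omega)
    set q := (n - k) / k
    have h2 : n < q * k + k + k := by omega
    nlinarith [Nat.zero_le (q * k)]
  have hn : (0 : ℝ) < n := by exact_mod_cast (by omega : 0 < n)
  rw [div_mul_eq_mul_div, div_le_div_iff₀ (by positivity) hn]
  have h2 : (n : ℝ) < 2 * k * ((((n - k) / k : ℕ) : ℝ) + 1) := by exact_mod_cast h1
  linarith

/-- In the `L²` term the factor `1/√k` cancels against the smoothing gain `√(2k/n)`; in the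
restriction term it is bounded by `1/√(ℓ+1)`. The result no longer depends on `k`, as the maximum in
`eta` requires. -/
theorem ofReal_tvNorm_div_sqrt_le (F G : Measure 𝔛) [IsProbabilityMeasure F]
    [IsProbabilityMeasure G] {f : 𝔛 → ℝ} {B : Set 𝔛} (hB : MeasurableSet B)
    (hf : IsDensity (F.restrict Bᶜ) G f) {n k ℓ : ℕ} (hk : k ∈ Icc (ℓ + 1) n) :
    ENNReal.ofReal (1 / √k * tvNorm ((F.toSignedMeasure - G.toSignedMeasure) *
        G.toSignedMeasure ^ ((n - k) / k))) ≤
      ENNReal.ofReal (1 / √((ℓ : ℝ) + 1) *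
          restrTerm (F.toSignedMeasure - G.toSignedMeasure) B) +
        ENNReal.ofReal √(2 / n) * l2Term G f B := by
  have hk1 : ((ℓ : ℝ) + 1) ≤ k := by exact_mod_cast hk.1
  have hk0 : (0 : ℝ) < k := by linarith [(Nat.cast_nonneg ℓ : (0 : ℝ) ≤ ℓ)]
  have hr : 0 ≤ restrTerm (F.toSignedMeasure - G.toSignedMeasure) B :=
    add_nonneg (tvNorm_nonneg _) (abs_nonneg _)
  rw [ENNReal.ofReal_mul (by positivity)]
  refine (mul_le_mul_right (ofReal_tvNorm_sub_mul_pow_le F G hB hf _) _).trans ?_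
  rw [mul_add, ← mul_assoc, ← ENNReal.ofReal_mul (by positivity),
    ← ENNReal.ofReal_mul (by positivity)]
  have h := one_div_floor_le (n := n) (k := k) (by linarith [hk.1]) hk.2
  refine add_le_add (ENNReal.ofReal_le_ofReal ?_)
    (mul_le_mul_left (ENNReal.ofReal_le_ofReal ?_) _)
  · gcongr
  · rw [one_div, inv_mul_le_iff₀ (by positivity), ← Real.sqrt_mul (by positivity)]
    exact Real.sqrt_le_sqrt (h.trans (le_of_eq (mul_comm _ _)))

theorem nuTilde_eq {n : ℕ} (hn : n ≠ 0) (F : Fin n → Measure 𝔛)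
    (G : Measure 𝔛) [∀ j, IsFiniteMeasure (F j)] [IsFiniteMeasure G] (k : ℕ) :
    nuTilde F G k = n * tvNorm (((meanMeasure F).toSignedMeasure - G.toSignedMeasure) *
      G.toSignedMeasure ^ ((n - k) / k)) := by
  have h : ∑ j, M F G j k = (n : ℝ) • (((meanMeasure F).toSignedMeasure - G.toSignedMeasure) *
      G.toSignedMeasure ^ ((n - k) / k)) := by
    simp only [M]
    rw [← Finset.sum_mul, Nat.cast_smul_eq_nsmul, ← smul_mul_assoc,
      ← sum_sub_eq_smul_meanMeasure_sub hn]
  rw [nuTilde, h, tvNorm_smul, Nat.abs_cast]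

theorem ofReal_eta_le {n : ℕ} (hn : n ≠ 0) (F : Fin n → Measure 𝔛) (G : Measure 𝔛)
    [∀ j, IsProbabilityMeasure (F j)] [IsProbabilityMeasure G]
    {B₀ : Set 𝔛} {f₀ : 𝔛 → ℝ} {B : Fin n → Set 𝔛} {f : Fin n → 𝔛 → ℝ}
    (hB₀ : MeasurableSet B₀) (hB : ∀ j, MeasurableSet (B j))
    (hf₀ : IsDensity ((meanMeasure F).restrict B₀ᶜ) G f₀)
    (hf : ∀ j, IsDensity ((F j).restrict (B j)ᶜ) G (f j)) (ℓ : ℕ) :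
    ENNReal.ofReal (eta F G ℓ 0) ≤
      ENNReal.ofReal (1 / (4 * c₁)) *
        (ENNReal.ofReal (n / √((ℓ : ℝ) + 1) *
            restrTerm ((meanMeasure F).toSignedMeasure - G.toSignedMeasure) B₀) +
          ENNReal.ofReal √(2 * n) * l2Term G f₀ B₀) ^ 2 +
      ∑ j, (ENNReal.ofReal (1 / √((ℓ : ℝ) + 1) *
            restrTerm ((F j).toSignedMeasure - G.toSignedMeasure) (B j)) +
          ENNReal.ofReal √(2 / n) * l2Term G (f j) (B j)) ^ 2 := by
  have hc := c₁_pos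
  have hn0 : (0 : ℝ) < n := by exact_mod_cast Nat.pos_of_ne_zero hn
  have := isProbabilityMeasure_meanMeasure hn F
  -- Testing against a finite upper bound `b` of the right side moves the estimate to `ℝ`, where the
  -- supremum lives; the nonnegativity of `b` covers the empty index set.
  refine le_of_forall_ge fun b hb => ?_
  rcases eq_or_ne b ⊤ with rfl | hb'
  · exact le_top
  rw [ENNReal.ofReal_le_iff_le_toReal hb']
  refine Real.sSup_le ?_ ENNReal.toReal_nonneg
  rintro _ ⟨k, hk, rfl⟩
  rw [← ENNReal.ofReal_le_iff_le_toReal hb']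
  refine le_trans ?_ hb
  have hk0 : (0 : ℝ) < k := by
    have : 0 < k := by linarith [hk.1]
    exact_mod_cast this
  -- The factor `1/k` is moved inside the squares as `1/√k`, so that each norm can be bounded
  -- separately.
  have e : 1 / (k : ℝ) ^ (1 + (0 : ℝ)) * (nuTilde F G k ^ 2 / (4 * c₁) + nu F G k 2) =
      1 / (4 * c₁) * (1 / √k * nuTilde F G k) ^ 2 + ∑ j, (1 / √k * tvNorm (M F G j k)) ^ 2 := by
    simp only [mul_pow, div_pow, Real.sq_sqrt hk0.le, add_zero, Real.rpow_one, nu]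
    rw [← Finset.mul_sum]
    field_simp
  have hM (j : Fin n) : 0 ≤ 1 / √k * tvNorm (M F G j k) :=
    mul_nonneg (by positivity) (tvNorm_nonneg _)
  have hN : 0 ≤ 1 / √k * nuTilde F G k := mul_nonneg (by positivity) (tvNorm_nonneg _)
  simp only [e]
  rw [ENNReal.ofReal_add (by positivity) (Finset.sum_nonneg fun j _ => sq_nonneg _),
    ENNReal.ofReal_mul (by positivity), ENNReal.ofReal_sum_of_nonneg fun j _ => sq_nonneg _,
    ENNReal.ofReal_pow hN]
  simp only [ENNReal.ofReal_pow (hM _)]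
  have hmean : ENNReal.ofReal (1 / √k * nuTilde F G k) ≤ ENNReal.ofReal (n / √((ℓ : ℝ) + 1) *
      restrTerm ((meanMeasure F).toSignedMeasure - G.toSignedMeasure) B₀) +
        ENNReal.ofReal √(2 * n) * l2Term G f₀ B₀ := by
    have h := mul_le_mul_right (ofReal_tvNorm_div_sqrt_le (meanMeasure F) G hB₀ hf₀ hk)
      (ENNReal.ofReal n)
    rw [mul_add, ← mul_assoc, ← ENNReal.ofReal_mul hn0.le, ← ENNReal.ofReal_mul hn0.le,
      ← ENNReal.ofReal_mul hn0.le] at h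
    have e1 : (n : ℝ) * √(2 / n) = √(2 * n) := by
      rw [← Real.sqrt_sq hn0.le, ← Real.sqrt_mul (sq_nonneg _), Real.sqrt_sq hn0.le]
      congr 1; field_simp
    rw [e1] at h
    rw [mul_left_comm, ← nuTilde_eq hn, ← mul_assoc (n : ℝ), mul_one_div] at h
    exact h
  gcongr with j
  exact ofReal_tvNorm_div_sqrt_le (F j) G (hB j) (hf j) hk

end Bound

end ConvExpansion

theorem theorem1 {𝔛 : Type*} [AddCommGroup 𝔛] [MeasurableSpace 𝔛] [MeasurableSub₂ 𝔛]
    (n : ℕ) (hn : 1 ≤ n) (F : Fin n → Measure 𝔛) (G : Measure 𝔛)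
    [∀ j, IsProbabilityMeasure (F j)] [IsProbabilityMeasure G] :
    -- the constant `c₁` is a genuine supremum and equals `0.694025…`
    (IsLUB (ConvExpansion.h₁ '' Ioi 0) ConvExpansion.c₁ ∧
      0.694025 ≤ ConvExpansion.c₁ ∧ ConvExpansion.c₁ < 0.694026) ∧
    -- part (a)
    (∀ α : ℝ, 0 ≤ α → ∀ ℓ : ℕ, ℓ ≤ n →
      ConvExpansion.eta F G ℓ 0 < (2 * Real.exp 1 * ConvExpansion.c₁)⁻¹ →
      ConvExpansion.tvNorm ((∏ j, (F j).toSignedMeasure) - ConvExpansion.W F G ℓ) ≤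
        ((ℓ : ℝ) + 1) ^ ⌈α * (ℓ + 1) / 2⌉₊ * (Nat.factorial ⌈α * (ℓ + 1) / 2⌉₊ : ℝ) *
          ((2 * Real.exp 1 * ConvExpansion.c₁ * ConvExpansion.eta F G ℓ α) ^ (((ℓ : ℝ) + 1) / 2) /
            (1 - √(2 * Real.exp 1 * ConvExpansion.c₁ * ConvExpansion.eta F G ℓ 0)) ^
              (⌈α * (ℓ + 1) / 2⌉₊ + 1))) ∧
    -- part (a) for `α = 0`
    (∀ ℓ : ℕ, ℓ ≤ n →
      ConvExpansion.eta F G ℓ 0 < (2 * Real.exp 1 * ConvExpansion.c₁)⁻¹ →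
      ConvExpansion.tvNorm ((∏ j, (F j).toSignedMeasure) - ConvExpansion.W F G ℓ) ≤
        (2 * Real.exp 1 * ConvExpansion.c₁ * ConvExpansion.eta F G ℓ 0) ^ (((ℓ : ℝ) + 1) / 2) /
          (1 - √(2 * Real.exp 1 * ConvExpansion.c₁ * ConvExpansion.eta F G ℓ 0))) ∧
    -- part (b); `B₀`, `f₀` belong to the mean `F̄`, and `B j`, `f j` to `F j`
    (∀ (B₀ : Set 𝔛) (f₀ : 𝔛 → ℝ) (B : Fin n → Set 𝔛) (f : Fin n → 𝔛 → ℝ),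
      MeasurableSet B₀ → (∀ j, MeasurableSet (B j)) →
      ConvExpansion.IsDensity ((ConvExpansion.meanMeasure F).restrict B₀ᶜ) G f₀ →
      (∀ j, ConvExpansion.IsDensity ((F j).restrict (B j)ᶜ) G (f j)) →
      ∀ ℓ : ℕ, ℓ ≤ n →
        ENNReal.ofReal (ConvExpansion.eta F G ℓ 0) ≤
          ENNReal.ofReal (1 / (4 * ConvExpansion.c₁)) *
            (ENNReal.ofReal (n / √((ℓ : ℝ) + 1) *
                ConvExpansion.restrTerm
                  ((ConvExpansion.meanMeasure F).toSignedMeasure - G.toSignedMeasure) B₀) +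
              ENNReal.ofReal √(2 * n) * ConvExpansion.l2Term G f₀ B₀) ^ 2 +
          ∑ j, (ENNReal.ofReal (1 / √((ℓ : ℝ) + 1) *
                ConvExpansion.restrTerm ((F j).toSignedMeasure - G.toSignedMeasure) (B j)) +
              ENNReal.ofReal √(2 / n) * ConvExpansion.l2Term G (f j) (B j)) ^ 2) := by
  -- For `α = 0` the ceiling `β` is 0, so the prefactors become 1 and the denominator has exponent
  -- 1.
  have hℓ0 (ℓ : ℕ) : ⌈(0 : ℝ) * (ℓ + 1) / 2⌉₊ = 0 := by simp
  refine ⟨⟨ConvExpansion.isLUB_c₁, ConvExpansion.le_c₁, ConvExpansion.c₁_lt⟩, ?_, ?_, ?_⟩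
  · exact fun α _ ℓ hℓ h => ConvExpansion.tvNorm_prod_sub_W_le F G α hℓ h
  · intro ℓ hℓ h
    simpa [hℓ0] using ConvExpansion.tvNorm_prod_sub_W_le F G 0 hℓ h
  · exact fun B₀ f₀ B f hB₀ hB hf₀ hf ℓ _ =>
      ConvExpansion.ofReal_eta_le (by omega) F G hB₀ hB hf₀ hf ℓ
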